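/- Let $(\widetilde M,\tilde g)$ be a connected smooth $5$-manifold with a Lorentzian metric of signature $(+,-,-,-,-)$ and let $(M,g)$ be a connected smooth $6$-manifold with a negative definite metric ("Riemannian" in the mostly minus convention). Equip $X=\widetilde M\times M$ with the product metric $h=\tilde g+g$, and let $F$ be a smooth $4$-form on $X$ that satisfies the supergravity Einstein equation $$\mathrm{Ric}_h(X,Y)=-\tfrac12\langle X\lrcorner F,\,Y\lrcorner F\rangle_h+\tfrac16\,h(X,Y)\,\|F\|_h^2$$ for all tangent vectors $X,Y$ at each point. Here $\langle\omega,\eta\rangle=\frac1{k!}\omega_{i_1\dots i_k}\eta_{j_1\dots j_k}h^{i_1j_1}\cdots h^{i_kj_k}$ for $k$-forms, $\|\omega\|^2=\langle\omega,\omega\rangle$ (which may be negative), and an Einstein metric with Einstein constant $\lambda$ is one with $\mathrm{Ric}=\lambda\cdot(\text{metric})$. Forms and functions with a tilde are smooth and live on $\widetilde M$, those without a tilde are smooth and live on $M$, and they are identified with their pullbacks to $X$. We write $\omega\not\equiv0$ if $\omega$ does not vanish identically. Then the following hold. 1. If $F=\tilde\alpha$ with $\tilde\alpha\in\Omega^4(\widetilde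 M)$, then $\|\tilde\alpha\|^2_{\tilde g}$ is constant and $(M,g)$ is Einstein with Einstein constant $\|\tilde\alpha\|^2_{\tilde g}/6$. 2. If $F=\tilde\beta\wedge\nu$ with $\tilde\beta\in\Omega^3(\widetilde M)$, $\nu\in\Omega^1(M)$ and $\nu\not\equiv0$, then $\|\tilde\beta\|^2_{\tilde g}$ is constant. 3. If $F=\tilde\gamma\wedge\delta$ with $\tilde\gamma\in\Omega^2(\widetilde M)$, $\delta\in\Omega^2(M)$, $\delta\not\equiv0$, and $\|\tilde\gamma\|^2_{\tilde g}$ is not constant, then $\|\delta\|_g^2>0$ everywhere, $g(X,Y)=\frac{3}{\|\delta\|_g^2}\langle X\lrcorner\delta,\,Y\lrcorner\delta\rangle_g$ for all $X,Y$ tangent to $M$, $(M,g)$ is Ricci-flat, and there is a smooth almost complex structure $J$ on $M$ with $g(JX,JY)=g(X,Y)$ and $\omega(X,Y)=g(JX,Y)$, where $\omega=\sqrt{3/\|\delta\|_g^2}\;\delta$. That is, $(M,g,J)$ is a Ricci-flat almost Hermitian manifold with Kähler form $\omega$. 4. If $F=\tilde\varpi\wedge\epsilon$ with $\tilde\varpi\in\Omega^1(\widetilde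 M)$, $\epsilon\in\Omega^3(M)$ and $\tilde\varpi\not\equiv0$, then $\|\epsilon\|_g^2$ is constant, and this constant is negative if $\epsilon\not\equiv0$. 5. If $F=\theta$ with $\theta\in\Omega^4(M)$, then $\|\theta\|_g^2$ is constant and $(\widetilde M,\tilde g)$ is Einstein with Einstein constant $\|\theta\|_g^2/6$, which is positive if $\theta\not\equiv0$. 6. If $F=\varphi\,\tilde\alpha+\tilde\beta\wedge\nu$ with $\varphi\in C^\infty(M)$, $\tilde\alpha\in\Omega^4(\widetilde M)$, $\tilde\beta\in\Omega^3(\widetilde M)$, $\nu\in\Omega^1(M)$, $\varphi\not\equiv0$ and $\nu\not\equiv0$, then $\|\tilde\beta\|^2_{\tilde g}$ and $\|\tilde\alpha\|^2_{\tilde g}$ are constant. 7. If $F=\tilde\varpi\wedge\epsilon+\tilde\psi\,\theta$ with $\tilde\varpi\in\Omega^1(\widetilde M)$, $\epsilon\in\Omega^3(M)$, $\tilde\psi\in C^\infty(\widetilde M)$, $\theta\in\Omega^4(M)$, $\tilde\varpi\not\equiv0$ and $\tilde\psi\not\equiv0$, then $\|\epsilon\|_g^2$ and $\|\theta\|_g^2$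 are constant. -/

import Mathlib

open scoped Manifold ContDiff

noncomputable section

namespace Supergravity

/-! ### Multilinear algebra on a vector space -/

section Algebra

variable {V : Type*} [AddCommGroup V] [Module ℝ V]

/-- The wedge product `α ∧ β`, i.e. the sum over `(k, l)`-shuffles
`(α ∧ β)(v₁, …, v_{k+l}) = ∑ sign σ · α(v_{σ 1}, …, v_{σ k}) β(v_{σ (k+1)}, …, v_{σ (k+l)})`. -/
def wedge {k l : ℕ} (α : V [⋀^Fin k]→ₗ[ℝ] ℝ) (β : V [⋀^Fin l]→ₗ[ℝ] ℝ) :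
    V [⋀^Fin (k + l)]→ₗ[ℝ] ℝ :=
  ((LinearMap.mul' ℝ ℝ).compAlternatingMap (α.domCoprod β)).domDomCongr finSumFinEquiv

/-- The Gram matrix `B_{ij} = B(b_i, b_j)` of a bilinear form. -/
def gram {ι : Type*} (b : Module.Basis ι ℝ V) (B : V →ₗ[ℝ] V →ₗ[ℝ] ℝ) : Matrix ι ι ℝ :=
  Matrix.of fun i j => B (b i) (b j)

/-- The inner product of `k`-forms induced by a nondegenerate symmetric bilinear form `B`,
`⟨ζ, η⟩ = (1/k!) ∑ ζ_{i₁…i_k} η_{j₁…j_k} B^{i₁j₁} ⋯ B^{i_kj_k}`, where `B^{ij}` is the inverse of the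
Gram matrix. The indices refer to the basis `b`; the value does not depend on `b`. -/
def formInner {ι : Type*} [Fintype ι] [DecidableEq ι] (b : Module.Basis ι ℝ V)
    (B : V →ₗ[ℝ] V →ₗ[ℝ] ℝ) {k : ℕ} (ζ η : V [⋀^Fin k]→ₗ[ℝ] ℝ) : ℝ :=
  (1 / (k.factorial : ℝ)) * ∑ s : Fin k → ι, ∑ t : Fin k → ι,
    ζ (fun a => b (s a)) * η (fun a => b (t a)) * ∏ a, (gram b B)⁻¹ (s a) (t a)

end Algebra

/-! ### Tensor fields on a manifold without boundary, modelled on `E`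

`b` is a basis of the model space `E`; it names the coordinates of the charts. -/

section Manifold

variable {E : Type*} [NormedAddCommGroup E] [NormedSpace ℝ E]
  {H : Type*} [TopologicalSpace H] (I : ModelWithCorners ℝ E H)
  (M : Type*) [TopologicalSpace M] [ChartedSpace H M]

/-- A (not necessarily smooth) field of bilinear forms on the tangent spaces of `M`. -/
abbrev BilinField : Type _ :=
  ∀ x : M, TangentSpace I x →ₗ[ℝ] TangentSpace I x →ₗ[ℝ] ℝ

/-- A (not necessarily smooth) differential `k`-form on `M`. -/
abbrev FormField (k : ℕ) : Type _ :=
  ∀ x : M, (TangentSpace I x) [⋀^Fin k]→ₗ[ℝ] ℝ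

/-- A (not necessarily smooth) field of endomorphisms of the tangent spaces of `M`. -/
abbrev EndField : Type _ :=
  ∀ x : M, TangentSpace I x →ₗ[ℝ] TangentSpace I x

variable {M} {ι : Type*}

/-- The `i`-th coordinate vector `∂_i` of the chart at `x₀`, at the point with coordinates `y`. -/
def coordVec (b : Module.Basis ι ℝ E) (x₀ : M) (y : E) (i : ι) :
    TangentSpace I ((extChartAt I x₀).symm y) :=
  mfderiv 𝓘(ℝ, E) I (extChartAt I x₀).symm y (b i)

/-- The tangent space `T_x M` is by definition the model space `E`, so `b` is a basis of it. -/
def tangentBasis (b : Module.Basis ι ℝ E) (x : M) : Module.Basis ι ℝ (TangentSpace I x) := b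

/-- The matrix `g_{ij}` in the chart at `x₀`, at the point with coordinates `y`. -/
def metricMatrix (b : Module.Basis ι ℝ E) (g : BilinField I M) (x₀ : M) (y : E) :
    Matrix ι ι ℝ :=
  Matrix.of fun i j =>
    g ((extChartAt I x₀).symm y) (coordVec I b x₀ y i) (coordVec I b x₀ y j)

/-- The components of `g` are smooth functions in the preferred charts, which cover `M`
(on a smooth manifold this gives smoothness in every chart). -/
def IsSmoothBilin (b : Module.Basis ι ℝ E) (g : BilinField I M) : Prop :=
  ∀ (x₀ : M) (i j : ι),
    ContDiffOn ℝ ∞ (fun y => metricMatrix I b g x₀ y i j) (extChartAt I x₀).target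

/-- The components of the `k`-form `ζ` are smooth functions in the preferred charts. -/
def IsSmoothForm (b : Module.Basis ι ℝ E) {k : ℕ} (ζ : FormField I M k) : Prop :=
  ∀ (x₀ : M) (s : Fin k → ι),
    ContDiffOn ℝ ∞
      (fun y => ζ ((extChartAt I x₀).symm y) (fun a => coordVec I b x₀ y (s a)))
      (extChartAt I x₀).target

/-- The components of the endomorphism field `J` are smooth functions in the preferred charts. -/
def IsSmoothEnd (b : Module.Basis ι ℝ E) (J : EndField I M) : Prop :=
  ∀ (x₀ : M) (i j : ι),
    ContDiffOn ℝ ∞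
      (fun y => b.repr (mfderiv I 𝓘(ℝ, E) (extChartAt I x₀) ((extChartAt I x₀).symm y)
        (J ((extChartAt I x₀).symm y) (coordVec I b x₀ y i))) j)
      (extChartAt I x₀).target

/-- The partial derivative `∂_i f`. -/
def partialDeriv (b : Module.Basis ι ℝ E) (i : ι) (f : E → ℝ) (y : E) : ℝ :=
  fderiv ℝ f y (b i)

/-- The Christoffel symbols of the Levi-Civita connection in the chart at `x₀`:
`Γ^k_{ij} = ½ ∑_l g^{kl} (∂_i g_{jl} + ∂_j g_{il} - ∂_l g_{ij})`. -/
def christoffel [Fintype ι] [DecidableEq ι] (b : Module.Basis ι ℝ E) (g : BilinField I M)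
    (x₀ : M) (k i j : ι) (y : E) : ℝ :=
  (1 / 2) * ∑ l, (metricMatrix I b g x₀ y)⁻¹ k l *
    (partialDeriv b i (fun z => metricMatrix I b g x₀ z j l) y
      + partialDeriv b j (fun z => metricMatrix I b g x₀ z i l) y
      - partialDeriv b l (fun z => metricMatrix I b g x₀ z i j) y)

/-- The components of the Ricci tensor in the chart at `x₀`:
`R_{ij} = ∑_k (∂_k Γ^k_{ij} - ∂_j Γ^k_{ik}) + ∑_{k,l} (Γ^k_{kl} Γ^l_{ij} - Γ^k_{jl} Γ^l_{ik})`. -/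
def ricciCoord [Fintype ι] [DecidableEq ι] (b : Module.Basis ι ℝ E) (g : BilinField I M)
    (x₀ : M) (i j : ι) (y : E) : ℝ :=
  ∑ k, (partialDeriv b k (christoffel I b g x₀ k i j) y
      - partialDeriv b j (christoffel I b g x₀ k i k) y)
    + ∑ k, ∑ l, (christoffel I b g x₀ k k l y * christoffel I b g x₀ l i j y
      - christoffel I b g x₀ k j l y * christoffel I b g x₀ l i k y)

/-- The Ricci tensor `Ric_g(X, Y)` at `x`, computed in the chart at `x`. -/
def ricci [Fintype ι] [DecidableEq ι] (b : Module.Basis ι ℝ E) (g : BilinField I M)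
    (x : M) (X Y : TangentSpace I x) : ℝ :=
  ∑ i, ∑ j, b.repr (mfderiv I 𝓘(ℝ, E) (extChartAt I x) x X) i
    * b.repr (mfderiv I 𝓘(ℝ, E) (extChartAt I x) x Y) j
    * ricciCoord I b g x i j (extChartAt I x x)

/-- `⟨ζ, η⟩_g` at the point `x`. -/
def innerAt [Fintype ι] [DecidableEq ι] (b : Module.Basis ι ℝ E) (g : BilinField I M)
    (x : M) {k : ℕ} (ζ η : (TangentSpace I x) [⋀^Fin k]→ₗ[ℝ] ℝ) : ℝ :=
  formInner (tangentBasis I b x) (g x) ζ η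

/-- The function `‖ζ‖²_g = ⟨ζ, ζ⟩_g`, which may be negative. -/
def normSq [Fintype ι] [DecidableEq ι] (b : Module.Basis ι ℝ E) (g : BilinField I M)
    {k : ℕ} (ζ : FormField I M k) (x : M) : ℝ :=
  innerAt I b g x (ζ x) (ζ x)

/-- `g` is Einstein with Einstein constant `c`: `Ric_g = c g`. -/
def IsEinstein [Fintype ι] [DecidableEq ι] (b : Module.Basis ι ℝ E) (g : BilinField I M)
    (c : ℝ) : Prop :=
  ∀ (x : M) (X Y : TangentSpace I x), ricci I b g x X Y = c * g x X Y

/-- The supergravity Einstein equation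
`Ric_h(X, Y) = -½ ⟨X ⌟ F, Y ⌟ F⟩_h + (1/6) h(X, Y) ‖F‖²_h`. -/
def SupergravityEinstein [Fintype ι] [DecidableEq ι] (b : Module.Basis ι ℝ E)
    (h : BilinField I M) (F : FormField I M 4) : Prop :=
  ∀ (x : M) (X Y : TangentSpace I x),
    ricci I b h x X Y =
      -(1 / 2) * innerAt I b h x ((F x).curryLeft X) ((F x).curryLeft Y)
        + (1 / 6) * h x X Y * normSq I b h F x

/-- A smooth Lorentzian metric of signature `(+, -, …, -)` on an `(n+1)`-manifold. -/
structure IsLorentzian {n : ℕ} (b : Module.Basis (Fin (n + 1)) ℝ E) (g : BilinField I M) :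
    Prop where
  smooth : IsSmoothBilin I b g
  orthonormal_basis : ∀ x : M, ∃ e : Module.Basis (Fin (n + 1)) ℝ (TangentSpace I x),
    ∀ i j, g x (e i) (e j) = if i = j then (if i = 0 then 1 else -1) else 0

/-- A smooth negative definite (Riemannian, in the mostly minus convention) metric. -/
structure IsNegRiemannian (b : Module.Basis ι ℝ E) (g : BilinField I M) : Prop where
  smooth : IsSmoothBilin I b g
  symm : ∀ (x : M) (X Y : TangentSpace I x), g x X Y = g x Y X
  neg : ∀ (x : M) (X : TangentSpace I x), X ≠ 0 → g x X X < 0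

/-- `(g, J)` is an almost Hermitian structure: `J` is a smooth almost complex structure and
`g(JX, JY) = g(X, Y)`. -/
structure IsAlmostHermitian (b : Module.Basis ι ℝ E) (g : BilinField I M) (J : EndField I M) :
    Prop where
  smooth : IsSmoothEnd I b J
  sq : ∀ (x : M) (X : TangentSpace I x), J x (J x X) = -X
  compat : ∀ (x : M) (X Y : TangentSpace I x), g x (J x X) (J x Y) = g x X Y

/-- `ζ` is the Kähler form of `(g, J)`: `ζ(X, Y) = g(JX, Y)`. -/
def IsKaehlerForm (g : BilinField I M) (J : EndField I M) (ζ : FormField I M 2) : Prop :=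
  ∀ (x : M) (X Y : TangentSpace I x), ζ x ![X, Y] = g x (J x X) Y

end Manifold

/-! ### Products -/

section Product

variable {E E' : Type*} [NormedAddCommGroup E] [NormedSpace ℝ E]
  [NormedAddCommGroup E'] [NormedSpace ℝ E']
  {H H' : Type*} [TopologicalSpace H] [TopologicalSpace H']
  {I : ModelWithCorners ℝ E H} {I' : ModelWithCorners ℝ E' H'}
  {M M' : Type*} [TopologicalSpace M] [ChartedSpace H M]
  [TopologicalSpace M'] [ChartedSpace H' M']

/-- The pullback of a form on the first factor to the product. -/
def pullFst (I' : ModelWithCorners ℝ E' H') (M' : Type*) [TopologicalSpace M']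
    [ChartedSpace H' M'] {k : ℕ} (ζ : FormField I M k) : FormField (I.prod I') (M × M') k :=
  fun p => (ζ p.1).compLinearMap (mfderiv (I.prod I') I Prod.fst p).toLinearMap

/-- The pullback of a form on the second factor to the product. -/
def pullSnd (I : ModelWithCorners ℝ E H) (M : Type*) [TopologicalSpace M]
    [ChartedSpace H M] {k : ℕ} (ζ : FormField I' M' k) : FormField (I.prod I') (M × M') k :=
  fun p => (ζ p.2).compLinearMap (mfderiv (I.prod I') I' Prod.snd p).toLinearMap

/-- The product metric `g + g'` on `M × M'`. -/
def prodMetric (g : BilinField I M) (g' : BilinField I' M') :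
    BilinField (I.prod I') (M × M') :=
  fun p =>
    (g p.1).compl₁₂ (mfderiv (I.prod I') I Prod.fst p).toLinearMap
        (mfderiv (I.prod I') I Prod.fst p).toLinearMap
      + (g' p.2).compl₁₂ (mfderiv (I.prod I') I' Prod.snd p).toLinearMap
        (mfderiv (I.prod I') I' Prod.snd p).toLinearMap

/-- The form `ζ ∧ η` on `M × M'`, for a form `ζ` on `M` and a form `η` on `M'`. -/
def wedgeProd {k l : ℕ} (ζ : FormField I M k) (η : FormField I' M' l) :
    FormField (I.prod I') (M × M') (k + l) :=
  fun p => wedge (pullFst I' M' ζ p) (pullSnd I M η p)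

end Product

/-- The standard basis of `ℝⁿ`. -/
def stdBasis (n : ℕ) : Module.Basis (Fin n) ℝ (EuclideanSpace ℝ (Fin n)) :=
  (EuclideanSpace.basisFun (Fin n) ℝ).toBasis

end Supergravity

end

open Supergravity

namespace Supergravity

section Pairing

variable {U V W : Type*} [AddCommGroup U] [Module ℝ U] [AddCommGroup V] [Module ℝ V]
  [AddCommGroup W] [Module ℝ W]
  {κ ι ι' : Type*} [Fintype κ] [Fintype ι] [Fintype ι'] {k l : ℕ}

/-- The pairing of `k`-forms induced by a matrix `A`, thought of as a bilinear form on the dual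
space: `(1/k!) ∑ ζ_{i₁…i_k} η_{j₁…j_k} A^{i₁j₁} ⋯ A^{i_kj_k}`. -/
noncomputable def pairing (b : Module.Basis κ ℝ U) (A : Matrix κ κ ℝ)
    (ζ η : U [⋀^Fin k]→ₗ[ℝ] ℝ) : ℝ :=
  (1 / (k.factorial : ℝ)) * ∑ s : Fin k → κ, ∑ t : Fin k → κ,
    ζ (fun a => b (s a)) * η (fun a => b (t a)) * ∏ a, A (s a) (t a)

theorem pairing_add_left (b : Module.Basis κ ℝ U) (A : Matrix κ κ ℝ)
    (ζ ζ' η : U [⋀^Fin k]→ₗ[ℝ] ℝ) :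
    pairing b A (ζ + ζ') η = pairing b A ζ η + pairing b A ζ' η := by
  simp only [pairing, AlternatingMap.add_apply, add_mul, Finset.sum_add_distrib, mul_add]

theorem pairing_smul_left (b : Module.Basis κ ℝ U) (A : Matrix κ κ ℝ) (c : ℝ)
    (ζ η : U [⋀^Fin k]→ₗ[ℝ] ℝ) :
    pairing b A (c • ζ) η = c * pairing b A ζ η := by
  simp only [pairing, AlternatingMap.smul_apply, smul_eq_mul, Finset.mul_sum]
  refine Finset.sum_congr rfl fun s _ => Finset.sum_congr rfl fun t _ => by ring

theorem pairing_transpose (b : Module.Basis κ ℝ U) (A : Matrix κ κ ℝ)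
    (ζ η : U [⋀^Fin k]→ₗ[ℝ] ℝ) :
    pairing b A.transpose η ζ = pairing b A ζ η := by
  simp only [pairing]
  rw [Finset.sum_comm]
  refine congrArg _ (Finset.sum_congr rfl fun s _ => Finset.sum_congr rfl fun t _ => ?_)
  simp only [Matrix.transpose_apply]
  ring

theorem pairing_add_right (b : Module.Basis κ ℝ U) (A : Matrix κ κ ℝ)
    (ζ η η' : U [⋀^Fin k]→ₗ[ℝ] ℝ) :
    pairing b A ζ (η + η') = pairing b A ζ η + pairing b A ζ η' := by
  simp only [← pairing_transpose b A ζ, pairing_add_left]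

theorem pairing_smul_right (b : Module.Basis κ ℝ U) (A : Matrix κ κ ℝ) (c : ℝ)
    (ζ η : U [⋀^Fin k]→ₗ[ℝ] ℝ) :
    pairing b A ζ (c • η) = c * pairing b A ζ η := by
  simp only [← pairing_transpose b A ζ, pairing_smul_left]

/-- The sum over all tuples of length `k + 1`, split off at the first entry. -/
theorem sum_fin_succ_fun {R : Type*} [AddCommMonoid R] (f : (Fin (k + 1) → κ) → R) :
    ∑ s, f s = ∑ i, ∑ s : Fin k → κ, f (Matrix.vecCons i s) := by
  rw [← (Fin.consEquiv fun _ => κ).sum_comp, Fintype.sum_prod_type]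
  rfl

theorem comp_vecCons {κ U : Type*} (b : κ → U) (i : κ) (s : Fin k → κ) :
    (fun a => b ((Matrix.vecCons i s : Fin (k + 1) → κ) a))
      = Matrix.vecCons (b i) (fun a => b (s a)) := by
  funext a
  refine Fin.cases rfl (fun a => rfl) a

/-- Contracting the two first arguments gives `k + 1` times the pairing. -/
theorem sum_mul_pairing_curryLeft (b : Module.Basis κ ℝ U) (A : Matrix κ κ ℝ)
    (ζ η : U [⋀^Fin (k + 1)]→ₗ[ℝ] ℝ) :
    ∑ i, ∑ j, A i j * pairing b A (ζ.curryLeft (b i)) (η.curryLeft (b j))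
      = (k + 1) * pairing b A ζ η := by
  have hk : ((k.factorial : ℕ) : ℝ) ≠ 0 := by positivity
  simp only [pairing, sum_fin_succ_fun, comp_vecCons, AlternatingMap.curryLeft_apply_apply,
    Fin.prod_univ_succ, Matrix.cons_val_zero, Matrix.cons_val_succ]
  rw [Nat.factorial_succ, ← mul_assoc]
  have : ((k : ℝ) + 1) * (1 / (((k + 1) * k.factorial : ℕ) : ℝ)) = 1 / (k.factorial : ℝ) := by
    push_cast
    field_simp
  rw [this, Finset.mul_sum]
  refine Finset.sum_congr rfl fun i _ => ?_
  rw [Finset.sum_comm (s := (Finset.univ : Finset (Fin k → κ)))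
    (t := (Finset.univ : Finset κ)), Finset.mul_sum]
  refine Finset.sum_congr rfl fun j _ => ?_
  simp only [Finset.mul_sum]
  refine Finset.sum_congr rfl fun s _ => Finset.sum_congr rfl fun t _ => ?_
  ring

/-- A sum over pairs of tuples is invariant under simultaneous permutations of the entries. -/
theorem sum_sum_comp_perm {n : Type*} [Fintype n] [DecidableEq n] (σ : Equiv.Perm n)
    (f : (n → κ) → (n → κ) → ℝ) :
    ∑ s, ∑ t, f (s ∘ σ) (t ∘ σ) = ∑ s, ∑ t, f s t := by
  have h (g : (n → κ) → ℝ) : ∑ s, g (s ∘ σ) = ∑ s, g s :=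
    Fintype.sum_equiv (Equiv.arrowCongr σ.symm (Equiv.refl κ)) _ _ fun s => rfl
  rw [← h fun s => ∑ t, f s t]
  exact Finset.sum_congr rfl fun s _ => h fun t => f (s ∘ σ) t

/-- The derivative of the pairing in the direction of a decomposable matrix is the pairing of the
interior products. -/
theorem hasDerivAt_pairing (b : Module.Basis κ ℝ U) (A : Matrix κ κ ℝ)
    (ζ η : U [⋀^Fin (k + 1)]→ₗ[ℝ] ℝ) (X Y : U) :
    HasDerivAt (fun τ : ℝ => pairing b (A + τ • Matrix.vecMulVec (b.repr X) (b.repr Y)) ζ η)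
      (pairing b A (ζ.curryLeft X) (η.curryLeft Y)) 0 := by
  have hk : ((k.factorial : ℕ) : ℝ) ≠ 0 := by positivity
  set E := Matrix.vecMulVec (b.repr X) (b.repr Y)
  let f (c : Fin (k + 1)) (s t : Fin (k + 1) → κ) : ℝ :=
    ζ (fun a => b (s a)) * η (fun a => b (t a)) *
      ((∏ a ∈ Finset.univ.erase c, A (s a) (t a)) * E (s c) (t c))
  have hd : HasDerivAt (fun τ : ℝ => pairing b (A + τ • E) ζ η)
      ((1 / ((k + 1).factorial : ℝ)) * ∑ s : Fin (k + 1) → κ, ∑ t : Fin (k + 1) → κ,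
        ζ (fun a => b (s a)) * η (fun a => b (t a)) *
          ∑ c, (∏ a ∈ Finset.univ.erase c, A (s a) (t a)) * E (s c) (t c)) 0 := by
    unfold pairing
    refine HasDerivAt.const_mul _ (HasDerivAt.fun_sum fun s _ => HasDerivAt.fun_sum fun t _ =>
      HasDerivAt.const_mul _ ?_)
    have := HasDerivAt.fun_finsetProd (u := Finset.univ) (x := (0 : ℝ))
      (f := fun c (τ : ℝ) => (A + τ • E) (s c) (t c)) (f' := fun c => E (s c) (t c))
      (fun c _ => by
        simpa using ((hasDerivAt_id (0 : ℝ)).mul_const (E (s c) (t c))).const_add (A (s c) (t c)))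
    simpa using this
  convert hd using 1
  have h1 : ∀ c, ∑ s, ∑ t, f c s t = ∑ s, ∑ t, f 0 s t := by
    intro c
    rw [← sum_sum_comp_perm (Equiv.swap 0 c) (f 0)]
    refine Finset.sum_congr rfl fun s _ => Finset.sum_congr rfl fun t _ => ?_
    simp only [f, Function.comp_apply, Equiv.swap_apply_left]
    have hζ := ζ.map_perm (fun a => b (s a)) (Equiv.swap 0 c)
    have hη := η.map_perm (fun a => b (t a)) (Equiv.swap 0 c)
    simp only [Function.comp_def] at hζ hη
    rw [hζ, hη]
    have hp : ∏ a ∈ Finset.univ.erase 0, A (s (Equiv.swap 0 c a)) (t (Equiv.swap 0 c a))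
        = ∏ a ∈ Finset.univ.erase c, A (s a) (t a) :=
      Finset.prod_equiv (Equiv.swap 0 c)
        (fun i => by
          simp only [Finset.mem_erase, Finset.mem_univ, and_true, ne_eq]
          rw [Equiv.swap_apply_eq_iff, Equiv.swap_apply_right]) fun _ _ => rfl
    rw [hp]
    rcases Int.units_eq_one_or (Equiv.Perm.sign (Equiv.swap 0 c)) with h | h <;> rw [h] <;> simp
  have h2 : ∑ s, ∑ t, f 0 s t = ∑ s : Fin k → κ, ∑ t : Fin k → κ,
      ζ (Matrix.vecCons X fun a => b (s a)) * η (Matrix.vecCons Y fun a => b (t a)) *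
        ∏ a, A (s a) (t a) := by
    have hX (ξ : U [⋀^Fin (k + 1)]→ₗ[ℝ] ℝ) (Z : U) (v : Fin k → U) :
        ξ (Matrix.vecCons Z v) = ∑ i, b.repr Z i * ξ (Matrix.vecCons (b i) v) := by
      let L : U →ₗ[ℝ] ℝ :=
        { toFun := fun Z => ξ (Matrix.vecCons Z v)
          map_add' := ξ.map_vecCons_add v
          map_smul' := ξ.map_vecCons_smul v }
      change L Z = ∑ i, b.repr Z i * L (b i)
      conv_lhs => rw [← b.sum_repr Z]
      simp only [map_sum, map_smul, smul_eq_mul]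
    have he : (Finset.univ.erase (0 : Fin (k + 1))) = Finset.univ.map (Fin.succEmb k) := by
      ext a
      refine Fin.cases ?_ (fun a => ?_) a <;> simp
    simp only [f, sum_fin_succ_fun, comp_vecCons, he, Finset.prod_map, Fin.coe_succEmb,
      Matrix.cons_val_zero, Matrix.cons_val_succ, E, Matrix.vecMulVec_apply]
    simp_rw [Finset.sum_comm (s := (Finset.univ : Finset κ))
      (t := (Finset.univ : Finset (Fin k → κ)))]
    refine Finset.sum_congr rfl fun s _ => Finset.sum_congr rfl fun t _ => ?_
    rw [hX ζ X, hX η Y, Finset.sum_mul_sum, Finset.sum_mul]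
    refine Finset.sum_congr rfl fun i _ => ?_
    rw [Finset.sum_mul]
    exact Finset.sum_congr rfl fun j _ => by ring
  simp only [pairing, AlternatingMap.curryLeft_apply_apply]
  rw [← h2]
  simp only [Finset.mul_sum (s := (Finset.univ : Finset (Fin (k + 1))))]
  have h3 : ∑ s, ∑ t, ∑ c, f c s t = (k + 1) * ∑ s, ∑ t, f 0 s t := by
    rw [Finset.sum_comm_cycle, Finset.sum_congr rfl fun c _ => h1 c]
    simp
  change _ = _ * ∑ s, ∑ t, ∑ c, f c s t
  rw [h3, Nat.factorial_succ]
  push_cast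
  field_simp

end Pairing

section Wedge

variable {U V W : Type*} [AddCommGroup U] [Module ℝ U] [AddCommGroup V] [Module ℝ V]
  [AddCommGroup W] [Module ℝ W] {k l : ℕ}

theorem wedge_apply (α : U [⋀^Fin k]→ₗ[ℝ] ℝ) (β : U [⋀^Fin l]→ₗ[ℝ] ℝ) (v : Fin k ⊕ Fin l → U) :
    wedge α β (fun a => v (finSumFinEquiv.symm a)) = LinearMap.mul' ℝ ℝ (α.domCoprod β v) := by
  simp [wedge, Function.comp_def]

/-- The wedge product as a sum over all permutations. -/
theorem factorial_mul_wedge_apply (α : U [⋀^Fin k]→ₗ[ℝ] ℝ) (β : U [⋀^Fin l]→ₗ[ℝ] ℝ)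
    (v : Fin k ⊕ Fin l → U) :
    (k.factorial * l.factorial : ℝ) * wedge α β (fun a => v (finSumFinEquiv.symm a))
      = ∑ σ : Equiv.Perm (Fin k ⊕ Fin l), ((Equiv.Perm.sign σ : ℤ) : ℝ) *
        (α (fun i => v (σ (Sum.inl i))) * β (fun j => v (σ (Sum.inr j)))) := by
  have h := congrArg (fun ξ => LinearMap.mul' ℝ ℝ (ξ v))
    (MultilinearMap.domCoprod_alternization_eq α β)
  simp only [MultilinearMap.alternatization_apply, AlternatingMap.smul_apply, map_sum,
    Fintype.card_fin, map_nsmul] at h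
  rw [nsmul_eq_mul, Nat.cast_mul] at h
  rw [wedge_apply, ← h]
  refine Finset.sum_congr rfl fun σ _ => ?_
  rw [Units.smul_def, map_zsmul, zsmul_eq_mul]
  simp

/-- The wedge product of forms on the two factors of a product, evaluated on vectors that are
tangent to the factors. -/
theorem wedge_prod_apply (α : V [⋀^Fin k]→ₗ[ℝ] ℝ) (β : W [⋀^Fin l]→ₗ[ℝ] ℝ)
    (v : Fin k → V) (w : Fin l → W) :
    wedge (α.compLinearMap (LinearMap.fst ℝ V W)) (β.compLinearMap (LinearMap.snd ℝ V W))
      (fun a => Sum.elim (fun i => (v i, (0 : W))) (fun j => ((0 : V), w j))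
        (finSumFinEquiv.symm a)) = α v * β w := by
  rw [wedge_apply, AlternatingMap.domCoprod_apply, sum_apply, map_sum]
  refine (Finset.sum_eq_single (Quotient.mk'' (1 : Equiv.Perm (Fin k ⊕ Fin l))) ?_ ?_).trans ?_
  rotate_left 2
  · rw [AlternatingMap.domCoprod.summand_mk'']
    simp
  · intro σ _ hσ
    induction σ using Quotient.inductionOn' with
    | h σ => ?_
    rw [AlternatingMap.domCoprod.summand_mk'']
    have : ∃ i j, σ (Sum.inl i) = Sum.inr j := by
      by_contra! hc
      refine hσ (Quotient.sound' (QuotientGroup.leftRel_apply.2 ?_))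
      rw [mul_one]
      refine inv_mem (Equiv.Perm.mem_sumCongrHom_range_of_perm_mapsTo_inl ?_)
      rintro _ ⟨i, rfl⟩
      rcases h : σ (Sum.inl i) with j | j
      · exact ⟨j, rfl⟩
      · exact absurd h (hc i j)
    obtain ⟨i, j, hij⟩ := this
    have h0 : α (fun i => (Sum.elim (fun i => (v i, (0 : W))) (fun j => ((0 : V), w j))
        (σ (Sum.inl i))).1) = 0 :=
      α.map_coord_zero i (by rw [hij]; rfl)
    simp [h0]
  · intro h
    exact absurd (Finset.mem_univ _) h


variable {κ ι ι' : Type*} [Fintype κ] [Fintype ι] [Fintype ι']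

/-- The pairing with a wedge product; all shuffles contribute equally. -/
theorem pairing_wedge (b : Module.Basis κ ℝ U) (A : Matrix κ κ ℝ) (ζ : U [⋀^Fin (k + l)]→ₗ[ℝ] ℝ)
    (α : U [⋀^Fin k]→ₗ[ℝ] ℝ) (β : U [⋀^Fin l]→ₗ[ℝ] ℝ) :
    pairing b A ζ (wedge α β) = (1 / (k.factorial * l.factorial : ℝ)) *
      ∑ s : Fin k ⊕ Fin l → κ, ∑ t : Fin k ⊕ Fin l → κ,
        ζ (fun a => b (s (finSumFinEquiv.symm a))) *
          (α (fun i => b (t (Sum.inl i))) * β (fun j => b (t (Sum.inr j)))) *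
            ∏ a, A (s a) (t a) := by
  have hk : (k.factorial : ℝ) ≠ 0 := by positivity
  have hl : (l.factorial : ℝ) ≠ 0 := by positivity
  have hkl : ((k + l).factorial : ℝ) ≠ 0 := by positivity
  let f (s t : Fin k ⊕ Fin l → κ) : ℝ :=
    ζ (fun a => b (s (finSumFinEquiv.symm a))) *
      (α (fun i => b (t (Sum.inl i))) * β (fun j => b (t (Sum.inr j)))) * ∏ a, A (s a) (t a)
  have hre (g : (Fin (k + l) → κ) → ℝ) :
      ∑ s, g s = ∑ s : Fin k ⊕ Fin l → κ, g (fun a => s (finSumFinEquiv.symm a)) :=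
    (Fintype.sum_equiv (Equiv.arrowCongr finSumFinEquiv (Equiv.refl κ)) _ _ fun s => rfl).symm
  have hprod (s t : Fin k ⊕ Fin l → κ) :
      ∏ a, A (s (finSumFinEquiv.symm a)) (t (finSumFinEquiv.symm a)) = ∏ a, A (s a) (t a) :=
    finSumFinEquiv.symm.prod_comp fun a => A (s a) (t a)
  have hperm (σ : Equiv.Perm (Fin k ⊕ Fin l)) (s t : Fin k ⊕ Fin l → κ) :
      ζ (fun a => b (s (finSumFinEquiv.symm a))) * (((Equiv.Perm.sign σ : ℤ) : ℝ) *
        (α (fun i => b (t (σ (Sum.inl i)))) * β (fun j => b (t (σ (Sum.inr j)))))) *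
          ∏ a, A (s a) (t a) = f (s ∘ σ) (t ∘ σ) := by
    have h1 := (ζ.domDomCongr finSumFinEquiv.symm).map_perm (fun a => b (s a)) σ
    simp only [AlternatingMap.domDomCongr_apply, Function.comp_def] at h1
    have h2 : ∏ a, A (s (σ a)) (t (σ a)) = ∏ a, A (s a) (t a) :=
      Equiv.prod_comp σ fun a => A (s a) (t a)
    simp only [f, Function.comp_apply, h1, h2]
    rcases Int.units_eq_one_or (Equiv.Perm.sign σ) with h | h <;> rw [h] <;> simp
  have hsum : (k.factorial * l.factorial : ℝ) * ∑ s : Fin (k + l) → κ, ∑ t : Fin (k + l) → κ,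
      ζ (fun a => b (s a)) * wedge α β (fun a => b (t a)) * ∏ a, A (s a) (t a)
        = (k + l).factorial * ∑ s, ∑ t, f s t := by
    simp only [hre, hprod]
    calc _ = ∑ s : Fin k ⊕ Fin l → κ, ∑ t : Fin k ⊕ Fin l → κ,
          ∑ σ : Equiv.Perm (Fin k ⊕ Fin l), f (s ∘ σ) (t ∘ σ) := by
          simp only [Finset.mul_sum]
          refine Finset.sum_congr rfl fun s _ => Finset.sum_congr rfl fun t _ => ?_
          rw [← Finset.sum_congr rfl fun σ _ => hperm σ s t, ← Finset.sum_mul, ← Finset.mul_sum,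
            ← factorial_mul_wedge_apply α β fun a => b (t a)]
          ring
      _ = _ := by
          rw [Finset.sum_comm_cycle, Finset.sum_congr rfl fun σ _ => sum_sum_comp_perm σ f]
          simp [Fintype.card_perm]
  change _ = _ * ∑ s, ∑ t, f s t
  rw [pairing]
  field_simp
  linear_combination hsum

/-- A sum over tuples in a sum type, when the summand sees only the tuples whose first part is in
the first summand and whose second part is in the second. -/
theorem sum_sum_type_fun {m n : Type*} [Fintype m] [Fintype n] [DecidableEq m] [DecidableEq n]
    (f : (m ⊕ n → ι ⊕ ι') → ℝ)
    (h₁ : ∀ s i j, s (Sum.inl i) = Sum.inr j → f s = 0)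
    (h₂ : ∀ s i j, s (Sum.inr i) = Sum.inl j → f s = 0) :
    ∑ s, f s = ∑ s : m → ι, ∑ t : n → ι', f (Sum.map s t) := by
  rw [← Fintype.sum_prod_type']
  symm
  refine Fintype.sum_of_injective (fun p : (m → ι) × (n → ι') => Sum.map p.1 p.2) ?_ _ _ ?_
    fun _ => rfl
  · rintro ⟨s, t⟩ ⟨s', t'⟩ h
    have h1 : s = s' := funext fun i => Sum.inl_injective (congrFun h (Sum.inl i))
    have h2 : t = t' := funext fun i => Sum.inr_injective (congrFun h (Sum.inr i))
    rw [h1, h2]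
  · intro s hs
    by_contra hf
    have g₁ : ∀ i, ∃ j, s (Sum.inl i) = Sum.inl j := fun i => by
      rcases h : s (Sum.inl i) with j | j
      · exact ⟨j, rfl⟩
      · exact absurd (h₁ s i j h) hf
    have g₂ : ∀ i, ∃ j, s (Sum.inr i) = Sum.inr j := fun i => by
      rcases h : s (Sum.inr i) with j | j
      · exact absurd (h₂ s i j h) hf
      · exact ⟨j, rfl⟩
    choose u hu using g₁
    choose v hv using g₂
    refine hs ⟨(u, v), ?_⟩
    funext a
    rcases a with a | a
    · exact (hu a).symm
    · exact (hv a).symm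

/-- The pairing of a form on a product with the wedge product of forms on the factors. -/
theorem pairing_wedge_prod (b : Module.Basis ι ℝ V) (b' : Module.Basis ι' ℝ W)
    (A : Matrix ι ι ℝ) (B : Matrix ι' ι' ℝ) (ζ : (V × W) [⋀^Fin (k + l)]→ₗ[ℝ] ℝ)
    (α : V [⋀^Fin k]→ₗ[ℝ] ℝ) (β : W [⋀^Fin l]→ₗ[ℝ] ℝ) :
    pairing (b.prod b') (Matrix.fromBlocks A 0 0 B) ζ
        (wedge (α.compLinearMap (LinearMap.fst ℝ V W)) (β.compLinearMap (LinearMap.snd ℝ V W)))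
      = (1 / (k.factorial * l.factorial : ℝ)) *
        ∑ s : Fin k → ι, ∑ s' : Fin l → ι', ∑ t : Fin k → ι, ∑ t' : Fin l → ι',
          ζ (fun a => Sum.elim (fun i => (b (s i), (0 : W))) (fun j => ((0 : V), b' (s' j)))
            (finSumFinEquiv.symm a)) * (α (fun i => b (t i)) * β (fun j => b' (t' j))) *
            ((∏ a, A (s a) (t a)) * ∏ a, B (s' a) (t' a)) := by
  rw [pairing_wedge, sum_sum_type_fun]
  · refine congrArg _ (Finset.sum_congr rfl fun s _ => Finset.sum_congr rfl fun s' _ => ?_)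
    rw [sum_sum_type_fun]
    · refine Finset.sum_congr rfl fun t _ => Finset.sum_congr rfl fun t' _ => ?_
      have hv : (fun a => (b.prod b') (Sum.map s s' (finSumFinEquiv.symm a))) =
          fun a => Sum.elim (fun i => (b (s i), (0 : W))) (fun j => ((0 : V), b' (s' j)))
            (finSumFinEquiv.symm a) := by
        funext a
        rcases finSumFinEquiv.symm a with i | i <;> simp
      rw [hv]
      simp [Fintype.prod_sum_type, Function.comp_def]
    · intro t i j h
      have : ∏ a, Matrix.fromBlocks A 0 0 B (Sum.map s s' a) (t a) = 0 :=
        Finset.prod_eq_zero (Finset.mem_univ (Sum.inl i)) (by rw [h]; simp)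
      rw [this, mul_zero]
    · intro t i j h
      have : ∏ a, Matrix.fromBlocks A 0 0 B (Sum.map s s' a) (t a) = 0 :=
        Finset.prod_eq_zero (Finset.mem_univ (Sum.inr i)) (by rw [h]; simp)
      rw [this, mul_zero]
  · intro s i j h
    refine Finset.sum_eq_zero fun t _ => ?_
    rcases h' : t (Sum.inl i) with c | c
    · have : ∏ a, Matrix.fromBlocks A 0 0 B (s a) (t a) = 0 :=
        Finset.prod_eq_zero (Finset.mem_univ (Sum.inl i)) (by rw [h, h']; simp)
      rw [this, mul_zero]
    · have : (α.compLinearMap (LinearMap.fst ℝ V W)) (fun i => b.prod b' (t (Sum.inl i))) = 0 :=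
        α.map_coord_zero i (by simp [h'])
      rw [this, zero_mul, mul_zero, zero_mul]
  · intro s i j h
    refine Finset.sum_eq_zero fun t _ => ?_
    rcases h' : t (Sum.inr i) with c | c
    · have : (β.compLinearMap (LinearMap.snd ℝ V W)) (fun i => b.prod b' (t (Sum.inr i))) = 0 :=
        β.map_coord_zero i (by simp [h'])
      rw [this, mul_zero, mul_zero, zero_mul]
    · have : ∏ a, Matrix.fromBlocks A 0 0 B (s a) (t a) = 0 :=
        Finset.prod_eq_zero (Finset.mem_univ (Sum.inr i)) (by rw [h, h']; simp)
      rw [this, mul_zero]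

/-- The pairing of wedge products of forms on the factors is the product of the pairings. -/
theorem pairing_wedge_wedge (b : Module.Basis ι ℝ V) (b' : Module.Basis ι' ℝ W)
    (A : Matrix ι ι ℝ) (B : Matrix ι' ι' ℝ) (α α' : V [⋀^Fin k]→ₗ[ℝ] ℝ)
    (β β' : W [⋀^Fin l]→ₗ[ℝ] ℝ) :
    pairing (b.prod b') (Matrix.fromBlocks A 0 0 B)
        (wedge (α.compLinearMap (LinearMap.fst ℝ V W)) (β.compLinearMap (LinearMap.snd ℝ V W)))
        (wedge (α'.compLinearMap (LinearMap.fst ℝ V W)) (β'.compLinearMap (LinearMap.snd ℝ V W)))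
      = pairing b A α α' * pairing b' B β β' := by
  rw [pairing_wedge_prod, pairing, pairing, one_div_mul_eq_div, one_div_mul_eq_div,
    one_div_mul_eq_div, div_mul_div_comm]
  congr 1
  rw [Finset.sum_mul_sum]
  refine Finset.sum_congr rfl fun s _ => Finset.sum_congr rfl fun s' _ => ?_
  rw [Finset.sum_mul_sum]
  refine Finset.sum_congr rfl fun t _ => Finset.sum_congr rfl fun t' _ => ?_
  rw [wedge_prod_apply]
  ring

/-- A form on the first factor is orthogonal to a wedge product of forms of positive degree. -/
theorem pairing_fst_wedge (b : Module.Basis ι ℝ V) (b' : Module.Basis ι' ℝ W)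
    (A : Matrix ι ι ℝ) (B : Matrix ι' ι' ℝ) (γ : V [⋀^Fin (k + (l + 1))]→ₗ[ℝ] ℝ)
    (α : V [⋀^Fin k]→ₗ[ℝ] ℝ) (β : W [⋀^Fin (l + 1)]→ₗ[ℝ] ℝ) :
    pairing (b.prod b') (Matrix.fromBlocks A 0 0 B) (γ.compLinearMap (LinearMap.fst ℝ V W))
        (wedge (α.compLinearMap (LinearMap.fst ℝ V W)) (β.compLinearMap (LinearMap.snd ℝ V W)))
      = 0 := by
  rw [pairing_wedge_prod]
  refine mul_eq_zero_of_right _ (Finset.sum_eq_zero fun s _ => Finset.sum_eq_zero fun s' _ =>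
    Finset.sum_eq_zero fun t _ => Finset.sum_eq_zero fun t' _ => ?_)
  have : (γ.compLinearMap (LinearMap.fst ℝ V W))
      (fun a => Sum.elim (fun i => (b (s i), (0 : W))) (fun j => ((0 : V), b' (s' j)))
        (finSumFinEquiv.symm a)) = 0 :=
    γ.map_coord_zero (finSumFinEquiv (Sum.inr 0)) (by simp)
  rw [this, zero_mul, zero_mul]

/-- A form on the second factor is orthogonal to a wedge product of forms of positive degree. -/
theorem pairing_snd_wedge (b : Module.Basis ι ℝ V) (b' : Module.Basis ι' ℝ W)
    (A : Matrix ι ι ℝ) (B : Matrix ι' ι' ℝ) (γ : W [⋀^Fin ((k + 1) + l)]→ₗ[ℝ] ℝ)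
    (α : V [⋀^Fin (k + 1)]→ₗ[ℝ] ℝ) (β : W [⋀^Fin l]→ₗ[ℝ] ℝ) :
    pairing (b.prod b') (Matrix.fromBlocks A 0 0 B) (γ.compLinearMap (LinearMap.snd ℝ V W))
        (wedge (α.compLinearMap (LinearMap.fst ℝ V W)) (β.compLinearMap (LinearMap.snd ℝ V W)))
      = 0 := by
  rw [pairing_wedge_prod]
  refine mul_eq_zero_of_right _ (Finset.sum_eq_zero fun s _ => Finset.sum_eq_zero fun s' _ =>
    Finset.sum_eq_zero fun t _ => Finset.sum_eq_zero fun t' _ => ?_)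
  have : (γ.compLinearMap (LinearMap.snd ℝ V W))
      (fun a => Sum.elim (fun i => (b (s i), (0 : W))) (fun j => ((0 : V), b' (s' j)))
        (finSumFinEquiv.symm a)) = 0 :=
    γ.map_coord_zero (finSumFinEquiv (Sum.inl 0)) (by simp)
  rw [this, zero_mul, zero_mul]

/-- The pairing of forms that are pulled back along a linear map which sends a basis vector either
to a basis vector or to zero. -/
theorem pairing_compLinearMap (b : Module.Basis ι ℝ V) (c : Module.Basis κ ℝ U)
    (A : Matrix ι ι ℝ) (C : Matrix κ κ ℝ) (L : U →ₗ[ℝ] V) (e : ι → κ) (he : Function.Injective e)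
    (hL : ∀ i, L (c (e i)) = b i) (hL0 : ∀ x ∉ Set.range e, L (c x) = 0)
    (hC : ∀ i j, C (e i) (e j) = A i j) (α α' : V [⋀^Fin k]→ₗ[ℝ] ℝ) :
    pairing c C (α.compLinearMap L) (α'.compLinearMap L) = pairing b A α α' := by
  have hinj : Function.Injective fun s : Fin k → ι => e ∘ s := fun s t h =>
    funext fun a => he (congrFun h a)
  have hz (ζ : V [⋀^Fin k]→ₗ[ℝ] ℝ) (s : Fin k → κ) (hs : s ∉ Set.range fun s : Fin k → ι => e ∘ s) :
      ζ (fun a => L (c (s a))) = 0 := by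
    have : ∃ a, s a ∉ Set.range e := by
      by_contra! h
      choose u hu using h
      exact hs ⟨u, funext hu⟩
    obtain ⟨a, ha⟩ := this
    exact ζ.map_coord_zero a (hL0 _ ha)
  simp only [pairing, AlternatingMap.compLinearMap_apply]
  congr 1
  symm
  refine Fintype.sum_of_injective _ hinj _ _ (fun s hs => ?_) fun s => ?_
  · simp [hz α s hs]
  · refine Fintype.sum_of_injective _ hinj _ _ (fun t ht => ?_) fun t => ?_
    · simp [hz α' t ht]
    · simp [hL, hC]

theorem pairing_fst (b : Module.Basis ι ℝ V) (b' : Module.Basis ι' ℝ W)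
    (A : Matrix ι ι ℝ) (B : Matrix ι' ι' ℝ) (α α' : V [⋀^Fin k]→ₗ[ℝ] ℝ) :
    pairing (b.prod b') (Matrix.fromBlocks A 0 0 B) (α.compLinearMap (LinearMap.fst ℝ V W))
      (α'.compLinearMap (LinearMap.fst ℝ V W)) = pairing b A α α' :=
  pairing_compLinearMap b _ A _ _ Sum.inl Sum.inl_injective (by simp) (by simp) (by simp) _ _

theorem pairing_snd (b : Module.Basis ι ℝ V) (b' : Module.Basis ι' ℝ W)
    (A : Matrix ι ι ℝ) (B : Matrix ι' ι' ℝ) (α α' : W [⋀^Fin k]→ₗ[ℝ] ℝ) :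
    pairing (b.prod b') (Matrix.fromBlocks A 0 0 B) (α.compLinearMap (LinearMap.snd ℝ V W))
      (α'.compLinearMap (LinearMap.snd ℝ V W)) = pairing b' B α α' :=
  pairing_compLinearMap b' _ B _ _ Sum.inr Sum.inr_injective (by simp) (by simp) (by simp) _ _

theorem pairing_zero_forms (b : Module.Basis κ ℝ U) (A : Matrix κ κ ℝ)
    (ζ η : U [⋀^Fin 0]→ₗ[ℝ] ℝ) (v : Fin 0 → U) : pairing b A ζ η = ζ v * η v := by
  simp [pairing, Subsingleton.elim _ v]

end Wedge

section LinearAlgebra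

variable {V W : Type*} [AddCommGroup V] [Module ℝ V] [AddCommGroup W] [Module ℝ W]
  {ι ι' : Type*} [Fintype ι] [Fintype ι'] {k l : ℕ}

theorem pairing_curryLeft_inr (b : Module.Basis ι ℝ V) (b' : Module.Basis ι' ℝ W)
    (A : Matrix ι ι ℝ) (B : Matrix ι' ι' ℝ) (F : (V × W) [⋀^Fin (k + 1)]→ₗ[ℝ] ℝ) (X Y : W) (d : ℝ)
    (h : HasDerivAt (fun τ : ℝ => pairing (b.prod b') (Matrix.fromBlocks A 0 0
      (B + τ • Matrix.vecMulVec (b'.repr X) (b'.repr Y))) F F) d 0) :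
    pairing (b.prod b') (Matrix.fromBlocks A 0 0 B) (F.curryLeft (0, X)) (F.curryLeft (0, Y))
      = d := by
  have h' := hasDerivAt_pairing (b.prod b') (Matrix.fromBlocks A 0 0 B) F F (0, X) (0, Y)
  have hE (τ : ℝ) : Matrix.fromBlocks A 0 0 B
      + τ • Matrix.vecMulVec ((b.prod b').repr (0, X)) ((b.prod b').repr (0, Y))
        = Matrix.fromBlocks A 0 0 (B + τ • Matrix.vecMulVec (b'.repr X) (b'.repr Y)) := by
    ext (i | i) (j | j) <;> simp [Matrix.vecMulVec_apply]
  simp only [hE] at h'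
  exact h'.unique h

theorem pairing_curryLeft_inl (b : Module.Basis ι ℝ V) (b' : Module.Basis ι' ℝ W)
    (A : Matrix ι ι ℝ) (B : Matrix ι' ι' ℝ) (F : (V × W) [⋀^Fin (k + 1)]→ₗ[ℝ] ℝ) (X Y : V) (d : ℝ)
    (h : HasDerivAt (fun τ : ℝ => pairing (b.prod b') (Matrix.fromBlocks
      (A + τ • Matrix.vecMulVec (b.repr X) (b.repr Y)) 0 0 B) F F) d 0) :
    pairing (b.prod b') (Matrix.fromBlocks A 0 0 B) (F.curryLeft (X, 0)) (F.curryLeft (Y, 0))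
      = d := by
  have h' := hasDerivAt_pairing (b.prod b') (Matrix.fromBlocks A 0 0 B) F F (X, 0) (Y, 0)
  have hE (τ : ℝ) : Matrix.fromBlocks A 0 0 B
      + τ • Matrix.vecMulVec ((b.prod b').repr (X, 0)) ((b.prod b').repr (Y, 0))
        = Matrix.fromBlocks (A + τ • Matrix.vecMulVec (b.repr X) (b.repr Y)) 0 0 B := by
    ext (i | i) (j | j) <;> simp [Matrix.vecMulVec_apply]
  simp only [hE] at h'
  exact h'.unique h

/-- The pairing of a form with itself is a sum of squares if the matrix is `Cᵀ C`. -/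
theorem pairing_self_of_transpose_mul (b : Module.Basis ι ℝ V) (C : Matrix ι ι ℝ)
    (ζ : V [⋀^Fin k]→ₗ[ℝ] ℝ) :
    pairing b (C.transpose * C) ζ ζ = (1 / (k.factorial : ℝ)) *
      ∑ r : Fin k → ι, ζ (fun a => ∑ i, C (r a) i • b i) ^ 2 := by
  classical
  have h1 (r : Fin k → ι) : ζ (fun a => ∑ i, C (r a) i • b i)
      = ∑ s : Fin k → ι, (∏ a, C (r a) (s a)) * ζ (fun a => b (s a)) := by
    have := ζ.toMultilinearMap.map_sum (fun a i => C (r a) i • b i)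
    refine this.trans (Finset.sum_congr rfl fun s _ => ?_)
    exact (ζ.toMultilinearMap.map_smul_univ (fun a => C (r a) (s a)) fun a => b (s a))
  have h2 (s t : Fin k → ι) : ∏ a, (C.transpose * C) (s a) (t a)
      = ∑ r : Fin k → ι, (∏ a, C (r a) (s a)) * ∏ a, C (r a) (t a) := by
    simp only [Matrix.mul_apply, Matrix.transpose_apply, ← Finset.prod_mul_distrib]
    rw [Finset.prod_univ_sum]
    simp
  rw [pairing]
  congr 1
  simp only [h2, Finset.mul_sum]
  rw [Finset.sum_comm_cycle]
  refine Finset.sum_congr rfl fun r _ => ?_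
  rw [h1, sq, Finset.sum_mul_sum]
  exact Finset.sum_congr rfl fun s _ => Finset.sum_congr rfl fun t _ => by ring

theorem pairing_neg (b : Module.Basis ι ℝ V) (A : Matrix ι ι ℝ) (ζ η : V [⋀^Fin k]→ₗ[ℝ] ℝ) :
    pairing b (-A) ζ η = (-1) ^ k * pairing b A ζ η := by
  simp only [pairing, Matrix.neg_apply, Finset.prod_neg, Finset.card_univ, Fintype.card_fin,
    Finset.mul_sum]
  refine Finset.sum_congr rfl fun s _ => Finset.sum_congr rfl fun t _ => by ring

open scoped MatrixOrder in
/-- The pairing on `k`-forms is definite if the matrix is negative definite. -/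
theorem pairing_self_pos [DecidableEq ι] (b : Module.Basis ι ℝ V) (A : Matrix ι ι ℝ)
    (hA : (-A).PosDef) (ζ : V [⋀^Fin k]→ₗ[ℝ] ℝ) (hζ : ζ ≠ 0) :
    0 < (-1) ^ k * pairing b A ζ ζ := by
  obtain ⟨C, hC, hAC⟩ : ∃ C : Matrix ι ι ℝ, IsUnit C ∧ -A = C.transpose * C := by
    obtain ⟨C, hC⟩ := CStarAlgebra.nonneg_iff_eq_star_mul_self.mp hA.posSemidef.nonneg
    refine ⟨C, ?_, hC⟩
    have := hA.isUnit
    rw [hC, Matrix.isUnit_iff_isUnit_det, Matrix.det_mul] at this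
    exact (Matrix.isUnit_iff_isUnit_det _).2 (isUnit_of_mul_isUnit_right this)
  rw [← pairing_neg, hAC, pairing_self_of_transpose_mul]
  refine mul_pos (by positivity) (lt_of_le_of_ne (Finset.sum_nonneg fun r _ => sq_nonneg _) ?_)
  intro h0
  refine hζ ?_
  have hz := (Finset.sum_eq_zero_iff_of_nonneg fun r _ => sq_nonneg _).1 h0.symm
  have hb (i : ι) : b i = ∑ j, C⁻¹ i j • ∑ m, C j m • b m := by
    simp only [Finset.smul_sum, smul_smul]
    rw [Finset.sum_comm]
    simp only [← Finset.sum_smul]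
    have : C⁻¹ * C = 1 := Matrix.nonsing_inv_mul _ ((Matrix.isUnit_iff_isUnit_det _).1 hC)
    have h (m : ι) : ∑ j, C⁻¹ i j * C j m = if i = m then 1 else 0 := by
      rw [← Matrix.mul_apply, this, Matrix.one_apply]
    simp [h]
  refine AlternatingMap.coe_multilinearMap_injective (Module.Basis.ext_multilinear (fun _ => b)
    fun s => ?_)
  change ζ.toMultilinearMap (fun a => b (s a)) = 0
  rw [show (fun a => b (s a)) = fun a => ∑ j, C⁻¹ (s a) j • ∑ m, C j m • b m from
    funext fun a => hb (s a)]
  have := ζ.toMultilinearMap.map_sum (fun a j => C⁻¹ (s a) j • ∑ m, C j m • b m)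
  refine this.trans (Finset.sum_eq_zero fun r _ => ?_)
  refine (ζ.toMultilinearMap.map_smul_univ (fun a => C⁻¹ (s a) (r a))
    fun a => ∑ m, C (r a) m • b m).trans ?_
  have := hz r (Finset.mem_univ r)
  rw [sq_eq_zero_iff] at this
  exact smul_eq_zero_of_right _ this

theorem apply_eq_sum_repr (b : Module.Basis ι ℝ V) (f : V →ₗ[ℝ] ℝ) (X : V) :
    f X = ∑ i, b.repr X i * f (b i) := by
  conv_lhs => rw [← b.sum_repr X]
  simp only [map_sum, map_smul, smul_eq_mul]

theorem gram_vecMul (b : Module.Basis ι ℝ V) (B : V →ₗ[ℝ] V →ₗ[ℝ] ℝ) (X : V) (j : ι) :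
    Matrix.vecMul (b.repr X) (gram b B) j = B X (b j) := by
  exact (apply_eq_sum_repr b (B.flip (b j)) X).symm

theorem isUnit_gram [DecidableEq ι] (b : Module.Basis ι ℝ V) (B : V →ₗ[ℝ] V →ₗ[ℝ] ℝ)
    (hB : ∀ X, (∀ Y, B X Y = 0) → X = 0) : IsUnit (gram b B) := by
  rw [← Matrix.vecMul_injective_iff_isUnit]
  refine (injective_iff_map_eq_zero (gram b B).vecMulLinear).2 fun v hv => ?_
  have hX := gram_vecMul b B (b.equivFun.symm v)
  have hr : ⇑(b.repr (b.equivFun.symm v)) = v := b.equivFun.apply_symm_apply v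
  rw [hr] at hX
  have h0 : B (b.equivFun.symm v) = 0 := b.ext fun j => by
    rw [← hX j]
    exact congrFun hv j
  have := hB _ fun Y => by rw [h0]; rfl
  exact b.equivFun.symm.map_eq_zero_iff.1 this

theorem neg_gram_inv_posDef [DecidableEq ι] (b : Module.Basis ι ℝ V) (B : V →ₗ[ℝ] V →ₗ[ℝ] ℝ)
    (hs : ∀ X Y, B X Y = B Y X) (hn : ∀ X, X ≠ 0 → B X X < 0) : (-(gram b B)⁻¹).PosDef := by
  have h : (-(gram b B)).PosDef := by
    refine Matrix.PosDef.of_dotProduct_mulVec_pos ?_ fun {x} hx => ?_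
    · ext i j
      simp [gram, hs (b i) (b j)]
    · have hX := gram_vecMul b B (b.equivFun.symm x)
      have hr : ⇑(b.repr (b.equivFun.symm x)) = x := b.equivFun.apply_symm_apply x
      rw [hr] at hX
      have h1 : dotProduct x (Matrix.mulVec (gram b B) x)
          = B (b.equivFun.symm x) (b.equivFun.symm x) := by
        rw [Matrix.dotProduct_mulVec]
        conv_rhs => rw [b.equivFun_symm_apply (x := x), map_sum]
        rw [← b.equivFun_symm_apply (x := x)]
        simp [dotProduct, hX, mul_comm]
      have := hn (b.equivFun.symm x) fun h => hx (b.equivFun.symm.map_eq_zero_iff.1 h)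
      simp only [star_trivial, Matrix.neg_mulVec, dotProduct_neg, h1]
      linarith
  have h2 := h.inv
  have h3 : (-(gram b B))⁻¹ = -(gram b B)⁻¹ := by
    have hu : IsUnit (gram b B).det := by
      have := h.isUnit.neg
      rw [neg_neg] at this
      exact (Matrix.isUnit_iff_isUnit_det _).1 this
    refine Matrix.inv_eq_right_inv ?_
    rw [neg_mul_neg, Matrix.mul_nonsing_inv _ hu]
  rwa [h3] at h2

/-- The pairing of the one-forms that are dual to two vectors. -/
theorem pairing_one_forms [DecidableEq ι] (b : Module.Basis ι ℝ V) (B : V →ₗ[ℝ] V →ₗ[ℝ] ℝ)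
    (hu : IsUnit (gram b B)) (ζ η : V [⋀^Fin 1]→ₗ[ℝ] ℝ) (X Y : V)
    (hζ : ∀ v, ζ v = B X (v 0)) (hη : ∀ v, η v = B Y (v 0)) :
    pairing b (gram b B)⁻¹ ζ η = B Y X := by
  have hu' := (Matrix.isUnit_iff_isUnit_det _).1 hu
  have h1 : pairing b (gram b B)⁻¹ ζ η = dotProduct
      (Matrix.vecMul (Matrix.vecMul (b.repr X) (gram b B)) (gram b B)⁻¹) fun j => B Y (b j) := by
    have e (f : (Fin 1 → ι) → ℝ) : ∑ s, f s = ∑ i, f (fun _ => i) :=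
      Fintype.sum_equiv (Equiv.funUnique (Fin 1) ι) _ _ fun s => by
        congr 1
        funext a
        rw [Subsingleton.elim a default]
        rfl
    simp only [pairing, e, hζ, hη, dotProduct, Matrix.vecMul, ← gram_vecMul b B X]
    simp only [Nat.factorial_one, Nat.cast_one, div_one, one_mul, Finset.univ_unique,
      Finset.prod_singleton, Finset.sum_mul]
    rw [Finset.sum_comm]
    refine Finset.sum_congr rfl fun i _ => Finset.sum_congr rfl fun j _ => ?_
    exact Finset.sum_congr rfl fun m _ => by ring
  rw [h1, Matrix.vecMul_vecMul, Matrix.mul_nonsing_inv _ hu', Matrix.vecMul_one]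
  exact (apply_eq_sum_repr b (B Y) X).symm

/-- A two-form is represented by an endomorphism with respect to a nondegenerate bilinear form. -/
theorem exists_endomorphism [DecidableEq ι] (b : Module.Basis ι ℝ V) (B : V →ₗ[ℝ] V →ₗ[ℝ] ℝ)
    (hu : IsUnit (gram b B)) (ζ : V [⋀^Fin 2]→ₗ[ℝ] ℝ) :
    ∃ J : V →ₗ[ℝ] V, ∀ X Y, ζ ![X, Y] = B (J X) Y := by
  have hu' := (Matrix.isUnit_iff_isUnit_det _).1 hu
  let L (Y : V) : V →ₗ[ℝ] ℝ :=
    { toFun := fun X => ζ ![X, Y]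
      map_add' := ζ.map_vecCons_add ![Y]
      map_smul' := ζ.map_vecCons_smul ![Y] }
  let J : V →ₗ[ℝ] V := ∑ i, ∑ j, ((gram b B)⁻¹ j i • L (b j)).smulRight (b i)
  have hJ (X : V) (m : ι) : B (J X) (b m) = ζ ![X, b m] := by
    have h (j : ι) : ∑ i, (gram b B)⁻¹ j i * B (b i) (b m) = if j = m then 1 else 0 := by
      have : ((gram b B)⁻¹ * gram b B) j m = if j = m then 1 else 0 := by
        rw [Matrix.nonsing_inv_mul _ hu', Matrix.one_apply]
      rwa [Matrix.mul_apply] at this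
    calc B (J X) (b m) = ∑ i, ∑ j, ((gram b B)⁻¹ j i * L (b j) X) * B (b i) (b m) := by
          simp [J]
      _ = ∑ j, (∑ i, (gram b B)⁻¹ j i * B (b i) (b m)) * L (b j) X := by
          rw [Finset.sum_comm]
          refine Finset.sum_congr rfl fun j _ => ?_
          rw [Finset.sum_mul]
          exact Finset.sum_congr rfl fun i _ => by ring
      _ = ζ ![X, b m] := by
          simp only [h]
          simp [L]
  refine ⟨J, fun X Y => ?_⟩
  have hup (Z : V) : Function.update ![X, 0] 1 Z = ![X, Z] := by
    ext i
    fin_cases i <;> simp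
  let R : V →ₗ[ℝ] ℝ :=
    { toFun := fun Y => ζ ![X, Y]
      map_add' := fun Y Z => by
        have := ζ.map_update_add ![X, 0] 1 Y Z
        rwa [hup, hup, hup] at this
      map_smul' := fun c Y => by
        have := ζ.map_update_smul ![X, 0] 1 c Y
        rwa [hup, hup] at this }
  have : R = B (J X) := b.ext fun m => (hJ X m).symm
  exact congrArg (fun f => f Y) this

/-- A covector that vanishes on the light cone is zero. -/
theorem exists_null_vector {n : ℕ} (hn : n ≠ 0) (B : V →ₗ[ℝ] V →ₗ[ℝ] ℝ)
    (e : Module.Basis (Fin (n + 1)) ℝ V)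
    (he : ∀ i j, B (e i) (e j) = if i = j then (if i = 0 then 1 else -1) else 0)
    (f : V →ₗ[ℝ] ℝ) (hf : f ≠ 0) : ∃ X, B X X = 0 ∧ f X ≠ 0 := by
  by_contra! h
  have hi (i : Fin (n + 1)) (hi : i ≠ 0) : f (e 0) = 0 ∧ f (e i) = 0 := by
    have h1 := h (e 0 + e i) (by simp [he, hi, hi.symm])
    have h2 := h (e 0 - e i) (by simp [he, hi, hi.symm])
    rw [map_add] at h1
    rw [map_sub] at h2
    constructor <;> linarith
  refine hf (e.ext fun i => ?_)
  by_cases h0 : i = 0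
  · subst h0
    exact (hi (Fin.last n) (by simpa [Fin.ext_iff] using hn)).1
  · exact (hi i h0).2

theorem lorentz_symm {n : ℕ} (B : V →ₗ[ℝ] V →ₗ[ℝ] ℝ) (e : Module.Basis (Fin (n + 1)) ℝ V)
    (he : ∀ i j, B (e i) (e j) = if i = j then (if i = 0 then 1 else -1) else 0) (X Y : V) :
    B X Y = B Y X := by
  have : B = B.flip := e.ext fun i => e.ext fun j => by
    rw [LinearMap.flip_apply, he, he]
    by_cases h : i = j
    · subst h; rfl
    · simp [h, Ne.symm h]
  exact congrArg (fun f => f X Y) this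

theorem lorentz_nondegenerate {n : ℕ} (B : V →ₗ[ℝ] V →ₗ[ℝ] ℝ)
    (e : Module.Basis (Fin (n + 1)) ℝ V)
    (he : ∀ i j, B (e i) (e j) = if i = j then (if i = 0 then 1 else -1) else 0) (X : V)
    (hX : ∀ Y, B X Y = 0) : X = 0 := by
  refine e.ext_elem fun j => ?_
  have h := hX (e j)
  rw [← LinearMap.flip_apply, apply_eq_sum_repr e] at h
  simp only [LinearMap.flip_apply, he] at h
  by_cases h0 : j = 0 <;> simpa [h0] using h

/-- In dimension at least two, a nonzero covector is nonzero on two orthogonal vectors. -/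
theorem exists_orthogonal_vectors (B : V →ₗ[ℝ] V →ₗ[ℝ] ℝ) (hn : ∀ X, X ≠ 0 → B X X < 0)
    (hs : ∀ X Y, B X Y = B Y X)
    (hV : 1 < Module.finrank ℝ V) (f : V →ₗ[ℝ] ℝ) (hf : f ≠ 0) :
    ∃ X Y, B X Y = 0 ∧ f X ≠ 0 ∧ f Y ≠ 0 := by
  obtain ⟨u, hu⟩ : ∃ u, f u ≠ 0 := by
    by_contra! h
    exact hf (LinearMap.ext h)
  have : FiniteDimensional ℝ V := FiniteDimensional.of_finrank_pos (by omega)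
  obtain ⟨z, hz, hz0⟩ := (Submodule.ne_bot_iff (LinearMap.ker (B u))).1
    (LinearMap.ker_ne_bot_of_finrank_lt (by rwa [Module.finrank_self]))
  rw [LinearMap.mem_ker] at hz
  by_cases hfz : f z = 0
  · have hzz := (hn z hz0).ne
    refine ⟨u + z, u - (B u u / B z z) • z, ?_, by simpa [hfz], by simpa [hfz]⟩
    have hzu : B z u = 0 := by rw [hs, hz]
    simp only [map_add, map_sub, map_smul, LinearMap.add_apply, smul_eq_mul, hz, hzu]
    field_simp
    ring
  · exact ⟨u, z, hz, hu, hfz⟩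

/-- If `⟨X ⌟ ζ, Y ⌟ ζ⟩` is a multiple of the metric, then the factor is determined by the trace. -/
theorem pairing_self_eq_zero_of_card_eq_five [DecidableEq ι] (hι : Fintype.card ι = 5)
    (b : Module.Basis ι ℝ V) (B : V →ₗ[ℝ] V →ₗ[ℝ] ℝ) (hs : ∀ X Y, B X Y = B Y X)
    (hu : IsUnit (gram b B)) (ζ : V [⋀^Fin 2]→ₗ[ℝ] ℝ)
    (h : ∀ X Y, B X Y * pairing b (gram b B)⁻¹ ζ ζ
      = 3 * pairing b (gram b B)⁻¹ (ζ.curryLeft X) (ζ.curryLeft Y)) :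
    pairing b (gram b B)⁻¹ ζ ζ = 0 := by
  have hu' := (Matrix.isUnit_iff_isUnit_det _).1 hu
  have htr : ∑ i, ∑ j, (gram b B)⁻¹ i j * B (b i) (b j) = 5 := by
    have : Matrix.trace ((gram b B)⁻¹ * gram b B) = 5 := by
      rw [Matrix.nonsing_inv_mul _ hu', Matrix.trace_one, hι]
      norm_num
    rw [← this]
    simp only [Matrix.trace, Matrix.diag, Matrix.mul_apply]
    exact Finset.sum_congr rfl fun i _ => Finset.sum_congr rfl fun j _ => by
      rw [hs]; rfl
  have h2 := sum_mul_pairing_curryLeft b (gram b B)⁻¹ ζ ζ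
  have h3 : (∑ i, ∑ j, (gram b B)⁻¹ i j * B (b i) (b j)) * pairing b (gram b B)⁻¹ ζ ζ
      = 3 * ∑ i, ∑ j, (gram b B)⁻¹ i j *
        pairing b (gram b B)⁻¹ (ζ.curryLeft (b i)) (ζ.curryLeft (b j)) := by
    simp only [Finset.sum_mul, Finset.mul_sum]
    refine Finset.sum_congr rfl fun i _ => Finset.sum_congr rfl fun j _ => ?_
    rw [mul_assoc, h]
    ring
  rw [htr, h2] at h3
  push_cast at h3
  linarith

end LinearAlgebra

section LocalRicci

variable {E E' : Type*} [NormedAddCommGroup E] [NormedSpace ℝ E]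
  [NormedAddCommGroup E'] [NormedSpace ℝ E'] {ι ι' : Type*}

theorem fderiv_comp_fst_apply (f : E → ℝ) (y v : E × E') :
    fderiv ℝ (fun z : E × E' => f z.1) y v = fderiv ℝ f y.1 v.1 := by
  by_cases hf : DifferentiableAt ℝ f y.1
  · have := (hf.hasFDerivAt.comp y hasFDerivAt_fst).fderiv
    exact congrArg (fun L => L v) this
  · have hf' : ¬ DifferentiableAt ℝ (fun z : E × E' => f z.1) y := fun h => by
      have h2 : DifferentiableAt ℝ (fun u : E => (u, y.2)) y.1 := by fun_prop
      exact hf (DifferentiableAt.comp y.1 (g := fun z : E × E' => f z.1) h h2)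
    rw [fderiv_zero_of_not_differentiableAt hf, fderiv_zero_of_not_differentiableAt hf']
    rfl

theorem fderiv_comp_snd_apply (f : E' → ℝ) (y v : E × E') :
    fderiv ℝ (fun z : E × E' => f z.2) y v = fderiv ℝ f y.2 v.2 := by
  by_cases hf : DifferentiableAt ℝ f y.2
  · have := (hf.hasFDerivAt.comp y hasFDerivAt_snd).fderiv
    exact congrArg (fun L => L v) this
  · have hf' : ¬ DifferentiableAt ℝ (fun z : E × E' => f z.2) y := fun h => by
      have h2 : DifferentiableAt ℝ (fun u : E' => (y.1, u)) y.2 := by fun_prop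
      exact hf (DifferentiableAt.comp y.2 (g := fun z : E × E' => f z.2) h h2)
    rw [fderiv_zero_of_not_differentiableAt hf, fderiv_zero_of_not_differentiableAt hf']
    rfl

section

variable (b : Module.Basis ι ℝ E) (b' : Module.Basis ι' ℝ E')

theorem partialDeriv_inl_fst (i : ι) (f : E → ℝ) (y : E × E') :
    partialDeriv (b.prod b') (Sum.inl i) (fun z => f z.1) y = partialDeriv b i f y.1 := by
  simp [partialDeriv, fderiv_comp_fst_apply]

theorem partialDeriv_inr_fst (i : ι') (f : E → ℝ) (y : E × E') :
    partialDeriv (b.prod b') (Sum.inr i) (fun z => f z.1) y = 0 := by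
  simp [partialDeriv, fderiv_comp_fst_apply]

theorem partialDeriv_inl_snd (i : ι) (f : E' → ℝ) (y : E × E') :
    partialDeriv (b.prod b') (Sum.inl i) (fun z => f z.2) y = 0 := by
  simp [partialDeriv, fderiv_comp_snd_apply]

theorem partialDeriv_inr_snd (i : ι') (f : E' → ℝ) (y : E × E') :
    partialDeriv (b.prod b') (Sum.inr i) (fun z => f z.2) y = partialDeriv b' i f y.2 := by
  simp [partialDeriv, fderiv_comp_snd_apply]

theorem partialDeriv_zero (i : ι) (y : E) : partialDeriv b i (fun _ => 0) y = 0 := by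
  simp [partialDeriv]

theorem partialDeriv_congr (i : ι) {f g : E → ℝ} {S : Set E} (hS : IsOpen S)
    (h : ∀ z ∈ S, f z = g z) {y : E} (hy : y ∈ S) :
    partialDeriv b i f y = partialDeriv b i g y := by
  have : f =ᶠ[nhds y] g := Filter.eventuallyEq_of_mem (hS.mem_nhds hy) h
  rw [partialDeriv, partialDeriv, this.fderiv_eq]

end

/-- The Christoffel symbols of a matrix-valued function. -/
noncomputable def localChristoffel [Fintype ι] [DecidableEq ι] (b : Module.Basis ι ℝ E)
    (G : E → Matrix ι ι ℝ) (k i j : ι) (y : E) : ℝ :=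
  (1 / 2) * ∑ l, (G y)⁻¹ k l *
    (partialDeriv b i (fun z => G z j l) y + partialDeriv b j (fun z => G z i l) y
      - partialDeriv b l (fun z => G z i j) y)

/-- The Ricci tensor of a matrix-valued function. -/
noncomputable def localRicci [Fintype ι] [DecidableEq ι] (b : Module.Basis ι ℝ E)
    (G : E → Matrix ι ι ℝ) (i j : ι) (y : E) : ℝ :=
  ∑ k, (partialDeriv b k (localChristoffel b G k i j) y
      - partialDeriv b j (localChristoffel b G k i k) y)
    + ∑ k, ∑ l, (localChristoffel b G k k l y * localChristoffel b G l i j y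
      - localChristoffel b G k j l y * localChristoffel b G l i k y)

section Block

variable [Fintype ι] [DecidableEq ι] [Fintype ι'] [DecidableEq ι']
  (b : Module.Basis ι ℝ E) (b' : Module.Basis ι' ℝ E')
  {G : E × E' → Matrix (ι ⊕ ι') (ι ⊕ ι') ℝ} {G₁ : E → Matrix ι ι ℝ} {G₂ : E' → Matrix ι' ι' ℝ}
  {S : Set (E × E')}

/-- The Christoffel symbols of a block diagonal metric. -/
theorem localChristoffel_block (hS : IsOpen S)
    (hG : ∀ z ∈ S, G z = Matrix.fromBlocks (G₁ z.1) 0 0 (G₂ z.2))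
    (h₁ : ∀ z ∈ S, IsUnit (G₁ z.1)) (h₂ : ∀ z ∈ S, IsUnit (G₂ z.2)) {y : E × E'} (hy : y ∈ S)
    (i j k : ι) (i' j' k' : ι') :
    localChristoffel (b.prod b') G (Sum.inl k) (Sum.inl i) (Sum.inl j) y
        = localChristoffel b G₁ k i j y.1 ∧
    localChristoffel (b.prod b') G (Sum.inr k') (Sum.inl i) (Sum.inl j) y = 0 ∧
    localChristoffel (b.prod b') G (Sum.inl k) (Sum.inr i') (Sum.inl j) y = 0 ∧
    localChristoffel (b.prod b') G (Sum.inl k) (Sum.inl i) (Sum.inr j') y = 0 ∧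
    localChristoffel (b.prod b') G (Sum.inl k) (Sum.inr i') (Sum.inr j') y = 0 ∧
    localChristoffel (b.prod b') G (Sum.inr k') (Sum.inl i) (Sum.inr j') y = 0 ∧
    localChristoffel (b.prod b') G (Sum.inr k') (Sum.inr i') (Sum.inl j) y = 0 ∧
    localChristoffel (b.prod b') G (Sum.inr k') (Sum.inr i') (Sum.inr j') y
        = localChristoffel b' G₂ k' i' j' y.2 := by
  have hinv : (G y)⁻¹ = Matrix.fromBlocks (G₁ y.1)⁻¹ 0 0 (G₂ y.2)⁻¹ := by
    rw [hG y hy, Matrix.inv_fromBlocks_zero₂₁_of_isUnit_iff _ _ _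
      (iff_of_true (h₁ y hy) (h₂ y hy))]
    simp
  have e₁ (a) (i j : ι) : partialDeriv (b.prod b') a (fun z => G z (Sum.inl i) (Sum.inl j)) y
      = partialDeriv (b.prod b') a (fun z => G₁ z.1 i j) y :=
    partialDeriv_congr _ _ hS (fun z hz => by rw [hG z hz]; rfl) hy
  have e₂ (a) (i : ι) (j : ι') :
      partialDeriv (b.prod b') a (fun z => G z (Sum.inl i) (Sum.inr j)) y = 0 :=
    (partialDeriv_congr _ _ hS (fun z hz => by rw [hG z hz]; rfl) hy).trans
      (partialDeriv_zero (b.prod b') a y)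
  have e₃ (a) (i : ι') (j : ι) :
      partialDeriv (b.prod b') a (fun z => G z (Sum.inr i) (Sum.inl j)) y = 0 :=
    (partialDeriv_congr _ _ hS (fun z hz => by rw [hG z hz]; rfl) hy).trans
      (partialDeriv_zero (b.prod b') a y)
  have e₄ (a) (i j : ι') : partialDeriv (b.prod b') a (fun z => G z (Sum.inr i) (Sum.inr j)) y
      = partialDeriv (b.prod b') a (fun z => G₂ z.2 i j) y :=
    partialDeriv_congr _ _ hS (fun z hz => by rw [hG z hz]; rfl) hy
  have f₁ (a : ι) (i j : ι) := partialDeriv_inl_fst b b' a (fun z => G₁ z i j) y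
  have f₂ (a : ι') (i j : ι) := partialDeriv_inr_fst b b' a (fun z => G₁ z i j) y
  have f₃ (a : ι) (i j : ι') := partialDeriv_inl_snd b b' a (fun z => G₂ z i j) y
  have f₄ (a : ι') (i j : ι') := partialDeriv_inr_snd b b' a (fun z => G₂ z i j) y
  simp [localChristoffel, hinv, Fintype.sum_sum_type, e₁, e₂, e₃, e₄, f₁, f₂, f₃, f₄]

/-- The Ricci tensor of a block diagonal metric. -/
theorem localRicci_block (hS : IsOpen S)
    (hG : ∀ z ∈ S, G z = Matrix.fromBlocks (G₁ z.1) 0 0 (G₂ z.2))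
    (h₁ : ∀ z ∈ S, IsUnit (G₁ z.1)) (h₂ : ∀ z ∈ S, IsUnit (G₂ z.2)) {y : E × E'} (hy : y ∈ S)
    [Nonempty ι] [Nonempty ι'] :
    (∀ i j, localRicci (b.prod b') G (Sum.inl i) (Sum.inl j) y = localRicci b G₁ i j y.1) ∧
    (∀ i j, localRicci (b.prod b') G (Sum.inr i) (Sum.inr j) y = localRicci b' G₂ i j y.2) := by
  obtain ⟨o⟩ := ‹Nonempty ι›
  obtain ⟨o'⟩ := ‹Nonempty ι'›
  have hΓ {z} (hz : z ∈ S) := localChristoffel_block b b' hS hG h₁ h₂ hz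
  have c₁ {z} (hz : z ∈ S) (k i j : ι) := (hΓ hz i j k o' o' o').1
  have c₂ {z} (hz : z ∈ S) (k : ι') (i j : ι) := (hΓ hz i j o o' o' k).2.1
  have c₃ {z} (hz : z ∈ S) (k : ι) (i : ι') (j : ι) := (hΓ hz o j k i o' o').2.2.1
  have c₄ {z} (hz : z ∈ S) (k : ι) (i : ι) (j : ι') := (hΓ hz i o k o' j o').2.2.2.1
  have c₅ {z} (hz : z ∈ S) (k : ι) (i j : ι') := (hΓ hz o o k i j o').2.2.2.2.1
  have c₆ {z} (hz : z ∈ S) (k : ι') (i : ι) (j : ι') := (hΓ hz i o o o' j k).2.2.2.2.2.1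
  have c₇ {z} (hz : z ∈ S) (k : ι') (i : ι') (j : ι) := (hΓ hz o j o i o' k).2.2.2.2.2.2.1
  have c₈ {z} (hz : z ∈ S) (k i j : ι') := (hΓ hz o o o i j k).2.2.2.2.2.2.2
  have z₀ (a) {f : E × E' → ℝ} (hf : ∀ z ∈ S, f z = 0) : partialDeriv (b.prod b') a f y = 0 :=
    (partialDeriv_congr _ _ hS hf hy).trans (partialDeriv_zero _ _ _)
  have d₁ (a) (k i j : ι) :
      partialDeriv (b.prod b') (Sum.inl a)
        (localChristoffel (b.prod b') G (Sum.inl k) (Sum.inl i) (Sum.inl j)) y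
        = partialDeriv b a (localChristoffel b G₁ k i j) y.1 :=
    (partialDeriv_congr _ _ hS (fun z hz => c₁ hz k i j) hy).trans
      (partialDeriv_inl_fst b b' a _ y)
  have d₈ (a) (k i j : ι') :
      partialDeriv (b.prod b') (Sum.inr a)
        (localChristoffel (b.prod b') G (Sum.inr k) (Sum.inr i) (Sum.inr j)) y
        = partialDeriv b' a (localChristoffel b' G₂ k i j) y.2 :=
    (partialDeriv_congr _ _ hS (fun z hz => c₈ hz k i j) hy).trans
      (partialDeriv_inr_snd b b' a _ y)
  have d₂ (a) (k : ι') (i j : ι) := z₀ a fun z hz => c₂ hz k i j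
  have d₃ (a) (k : ι) (i : ι') (j : ι) := z₀ a fun z hz => c₃ hz k i j
  have d₅ (a) (k : ι) (i j : ι') := z₀ a fun z hz => c₅ hz k i j
  have d₆ (a) (k : ι') (i : ι) (j : ι') := z₀ a fun z hz => c₆ hz k i j
  constructor <;> intro i j
  · simp [localRicci, Fintype.sum_sum_type, d₁, d₂, d₆, c₁ hy, c₂ hy, c₄ hy, c₆ hy, c₇ hy]
  · simp [localRicci, Fintype.sum_sum_type, d₃, d₅, d₈, c₃ hy, c₄ hy, c₅ hy, c₇ hy, c₈ hy]

end Block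

end LocalRicci

section ManifoldRicci

variable {E E' : Type*} [NormedAddCommGroup E] [NormedSpace ℝ E]
  [NormedAddCommGroup E'] [NormedSpace ℝ E']
  {H H' : Type*} [TopologicalSpace H] [TopologicalSpace H']
  {I : ModelWithCorners ℝ E H} {I' : ModelWithCorners ℝ E' H'}
  {M M' : Type*} [TopologicalSpace M] [ChartedSpace H M]
  [TopologicalSpace M'] [ChartedSpace H' M']
  {ι ι' : Type*}


theorem mdifferentiableAt_extChartAt_symm [I.Boundaryless] [IsManifold I 1 M] {x : M} {z : E}
    (hz : z ∈ (extChartAt I x).target) :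
    MDifferentiableAt 𝓘(ℝ, E) I (extChartAt I x).symm z := by
  have := mdifferentiableWithinAt_extChartAt_symm hz
  rwa [I.range_eq_univ, mdifferentiableWithinAt_univ] at this

theorem mfderiv_extChartAt_coordVec [I.Boundaryless] [IsManifold I 1 M]
    (b : Module.Basis ι ℝ E) {x : M} {z : E} (hz : z ∈ (extChartAt I x).target) (i : ι) :
    mfderiv I 𝓘(ℝ, E) (extChartAt I x) ((extChartAt I x).symm z) (coordVec I b x z i) = b i := by
  have := mfderiv_extChartAt_comp_mfderivWithin_extChartAt_symm hz
  rw [I.range_eq_univ, mfderivWithin_univ] at this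
  exact congrArg (fun L => L (b i)) this

/-- The coordinate vectors form a basis of the tangent space. -/
theorem exists_basis_coordVec [I.Boundaryless] [IsManifold I 1 M]
    (b : Module.Basis ι ℝ E) {x : M} {z : E} (hz : z ∈ (extChartAt I x).target) :
    ∃ c : Module.Basis ι ℝ (TangentSpace I ((extChartAt I x).symm z)),
      ∀ i, c i = coordVec I b x z i := by
  have h₁ := mfderiv_extChartAt_comp_mfderivWithin_extChartAt_symm hz
  have h₂ := mfderivWithin_extChartAt_symm_comp_mfderiv_extChartAt hz
  rw [I.range_eq_univ, mfderivWithin_univ] at h₁ h₂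
  let L : E ≃ₗ[ℝ] TangentSpace I ((extChartAt I x).symm z) :=
    LinearEquiv.ofLinearMap (mfderiv 𝓘(ℝ, E) I (extChartAt I x).symm z).toLinearMap
      (mfderiv I 𝓘(ℝ, E) (extChartAt I x) ((extChartAt I x).symm z)).toLinearMap
      (LinearMap.ext fun v => congrArg (fun L => L v) h₂)
      (LinearMap.ext fun v => congrArg (fun L => L v) h₁)
  exact ⟨b.map L, fun i => rfl⟩

theorem metricMatrix_isUnit [Fintype ι] [DecidableEq ι] [I.Boundaryless] [IsManifold I 1 M]
    (b : Module.Basis ι ℝ E) (g : BilinField I M)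
    (hg : ∀ x X, (∀ Y, g x X Y = 0) → X = 0) {x : M} {z : E} (hz : z ∈ (extChartAt I x).target) :
    IsUnit (metricMatrix I b g x z) := by
  obtain ⟨c, hc⟩ := exists_basis_coordVec (I := I) b hz
  have := isUnit_gram c (g ((extChartAt I x).symm z)) (hg _)
  have h : gram c (g ((extChartAt I x).symm z)) = metricMatrix I b g x z := by
    ext i j
    rw [gram, metricMatrix, Matrix.of_apply, Matrix.of_apply, hc, hc]
  rwa [h] at this

theorem mfderiv_fst_coordVec [I.Boundaryless] [IsManifold I 1 M] [I'.Boundaryless]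
    [IsManifold I' 1 M'] (b : Module.Basis ι ℝ E) (b' : Module.Basis ι' ℝ E') (p : M × M')
    {z : E × E'} (hz₁ : z.1 ∈ (extChartAt I p.1).target) (hz₂ : z.2 ∈ (extChartAt I' p.2).target)
    (a : ι ⊕ ι') :
    mfderiv (I.prod I') I Prod.fst ((extChartAt (I.prod I') p).symm z)
        (coordVec (I.prod I') (b.prod b') p z a)
      = mfderiv 𝓘(ℝ, E) I (extChartAt I p.1).symm z.1 (b.prod b' a).1 := by
  have hz : z ∈ (extChartAt (I.prod I') p).target := by
    rw [extChartAt_prod]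
    exact ⟨hz₁, hz₂⟩
  have h₁ := mfderiv_comp (I := 𝓘(ℝ, E × E')) (I' := I.prod I') (I'' := I) z (g := Prod.fst)
    (f := (extChartAt (I.prod I') p).symm) mdifferentiableAt_fst
    (mdifferentiableAt_extChartAt_symm hz)
  have hf : MDifferentiableAt 𝓘(ℝ, E × E') 𝓘(ℝ, E) (Prod.fst : E × E' → E) z :=
    differentiableAt_fst.mdifferentiableAt
  have h₂ := mfderiv_comp (I := 𝓘(ℝ, E × E')) (I' := 𝓘(ℝ, E)) (I'' := I) z
    (g := (extChartAt I p.1).symm) (f := (Prod.fst : E × E' → E))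
    (mdifferentiableAt_extChartAt_symm hz₁) hf
  have h₃ := h₁.symm.trans h₂
  rw [mfderiv_eq_fderiv, fderiv_fst] at h₃
  exact congrArg (fun L => L (b.prod b' a)) h₃

theorem mfderiv_fst_coordVec_inl [I.Boundaryless] [IsManifold I 1 M] [I'.Boundaryless]
    [IsManifold I' 1 M'] (b : Module.Basis ι ℝ E) (b' : Module.Basis ι' ℝ E') (p : M × M')
    {z : E × E'} (hz₁ : z.1 ∈ (extChartAt I p.1).target) (hz₂ : z.2 ∈ (extChartAt I' p.2).target)
    (i : ι) :
    mfderiv (I.prod I') I Prod.fst ((extChartAt (I.prod I') p).symm z)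
        (coordVec (I.prod I') (b.prod b') p z (Sum.inl i)) = coordVec I b p.1 z.1 i :=
  (mfderiv_fst_coordVec b b' p hz₁ hz₂ _).trans (by rw [Module.Basis.prod_apply_inl_fst]; rfl)

theorem mfderiv_fst_coordVec_inr [I.Boundaryless] [IsManifold I 1 M] [I'.Boundaryless]
    [IsManifold I' 1 M'] (b : Module.Basis ι ℝ E) (b' : Module.Basis ι' ℝ E') (p : M × M')
    {z : E × E'} (hz₁ : z.1 ∈ (extChartAt I p.1).target) (hz₂ : z.2 ∈ (extChartAt I' p.2).target)
    (i : ι') :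
    mfderiv (I.prod I') I Prod.fst ((extChartAt (I.prod I') p).symm z)
        (coordVec (I.prod I') (b.prod b') p z (Sum.inr i)) = 0 :=
  (mfderiv_fst_coordVec b b' p hz₁ hz₂ _).trans
    (by rw [Module.Basis.prod_apply_inr_fst]; exact map_zero _)

theorem mfderiv_snd_coordVec [I.Boundaryless] [IsManifold I 1 M] [I'.Boundaryless]
    [IsManifold I' 1 M'] (b : Module.Basis ι ℝ E) (b' : Module.Basis ι' ℝ E') (p : M × M')
    {z : E × E'} (hz₁ : z.1 ∈ (extChartAt I p.1).target) (hz₂ : z.2 ∈ (extChartAt I' p.2).target)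
    (a : ι ⊕ ι') :
    mfderiv (I.prod I') I' Prod.snd ((extChartAt (I.prod I') p).symm z)
        (coordVec (I.prod I') (b.prod b') p z a)
      = mfderiv 𝓘(ℝ, E') I' (extChartAt I' p.2).symm z.2 (b.prod b' a).2 := by
  have hz : z ∈ (extChartAt (I.prod I') p).target := by
    rw [extChartAt_prod]
    exact ⟨hz₁, hz₂⟩
  have h₁ := mfderiv_comp (I := 𝓘(ℝ, E × E')) (I' := I.prod I') (I'' := I') z (g := Prod.snd)
    (f := (extChartAt (I.prod I') p).symm) mdifferentiableAt_snd
    (mdifferentiableAt_extChartAt_symm hz)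
  have hf : MDifferentiableAt 𝓘(ℝ, E × E') 𝓘(ℝ, E') (Prod.snd : E × E' → E') z :=
    differentiableAt_snd.mdifferentiableAt
  have h₂ := mfderiv_comp (I := 𝓘(ℝ, E × E')) (I' := 𝓘(ℝ, E')) (I'' := I') z
    (g := (extChartAt I' p.2).symm) (f := (Prod.snd : E × E' → E'))
    (mdifferentiableAt_extChartAt_symm hz₂) hf
  have h₃ := h₁.symm.trans h₂
  rw [mfderiv_eq_fderiv, fderiv_snd] at h₃
  exact congrArg (fun L => L (b.prod b' a)) h₃

theorem mfderiv_snd_coordVec_inr [I.Boundaryless] [IsManifold I 1 M] [I'.Boundaryless]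
    [IsManifold I' 1 M'] (b : Module.Basis ι ℝ E) (b' : Module.Basis ι' ℝ E') (p : M × M')
    {z : E × E'} (hz₁ : z.1 ∈ (extChartAt I p.1).target) (hz₂ : z.2 ∈ (extChartAt I' p.2).target)
    (i : ι') :
    mfderiv (I.prod I') I' Prod.snd ((extChartAt (I.prod I') p).symm z)
        (coordVec (I.prod I') (b.prod b') p z (Sum.inr i)) = coordVec I' b' p.2 z.2 i :=
  (mfderiv_snd_coordVec b b' p hz₁ hz₂ _).trans (by rw [Module.Basis.prod_apply_inr_snd]; rfl)

theorem mfderiv_snd_coordVec_inl [I.Boundaryless] [IsManifold I 1 M] [I'.Boundaryless]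
    [IsManifold I' 1 M'] (b : Module.Basis ι ℝ E) (b' : Module.Basis ι' ℝ E') (p : M × M')
    {z : E × E'} (hz₁ : z.1 ∈ (extChartAt I p.1).target) (hz₂ : z.2 ∈ (extChartAt I' p.2).target)
    (i : ι) :
    mfderiv (I.prod I') I' Prod.snd ((extChartAt (I.prod I') p).symm z)
        (coordVec (I.prod I') (b.prod b') p z (Sum.inl i)) = 0 :=
  (mfderiv_snd_coordVec b b' p hz₁ hz₂ _).trans
    (by rw [Module.Basis.prod_apply_inl_snd]; exact map_zero _)

theorem mfderiv_extChartAt_prod [IsManifold I 1 M] [IsManifold I' 1 M'] (p : M × M')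
    (X : TangentSpace I p.1) (Y : TangentSpace I' p.2) :
    mfderiv (I.prod I') 𝓘(ℝ, E × E') (extChartAt (I.prod I') p) p ((X, Y) : E × E')
      = (mfderiv I 𝓘(ℝ, E) (extChartAt I p.1) p.1 X,
        mfderiv I' 𝓘(ℝ, E') (extChartAt I' p.2) p.2 Y) := by
  have hp : MDifferentiableAt (I.prod I') 𝓘(ℝ, E × E') (extChartAt (I.prod I') p) p :=
    mdifferentiableAt_extChartAt (mem_chart_source _ p)
  have h₁ := mfderiv_comp (I := I.prod I') (I' := 𝓘(ℝ, E × E')) (I'' := 𝓘(ℝ, E)) p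
    (g := (Prod.fst : E × E' → E)) differentiableAt_fst.mdifferentiableAt hp
  have h₁' := mfderiv_comp (I := I.prod I') (I' := I) (I'' := 𝓘(ℝ, E)) p
    (g := extChartAt I p.1) (f := (Prod.fst : M × M' → M))
    (mdifferentiableAt_extChartAt (mem_chart_source _ p.1)) mdifferentiableAt_fst
  have h₂ := mfderiv_comp (I := I.prod I') (I' := 𝓘(ℝ, E × E')) (I'' := 𝓘(ℝ, E')) p
    (g := (Prod.snd : E × E' → E')) differentiableAt_snd.mdifferentiableAt hp
  have h₂' := mfderiv_comp (I := I.prod I') (I' := I') (I'' := 𝓘(ℝ, E')) p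
    (g := extChartAt I' p.2) (f := (Prod.snd : M × M' → M'))
    (mdifferentiableAt_extChartAt (mem_chart_source _ p.2)) mdifferentiableAt_snd
  have h₃ := h₁.symm.trans h₁'
  have h₄ := h₂.symm.trans h₂'
  rw [mfderiv_eq_fderiv, fderiv_fst, mfderiv_fst] at h₃
  rw [mfderiv_eq_fderiv, fderiv_snd, mfderiv_snd] at h₄
  exact Prod.ext (congrArg (fun L => L ((X, Y) : E × E')) h₃)
    (congrArg (fun L => L ((X, Y) : E × E')) h₄)

theorem prodMetric_apply (g : BilinField I M) (g' : BilinField I' M') (p : M × M')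
    (X Y : TangentSpace (I.prod I') p) :
    prodMetric g g' p X Y = g p.1 (mfderiv (I.prod I') I Prod.fst p X)
        (mfderiv (I.prod I') I Prod.fst p Y)
      + g' p.2 (mfderiv (I.prod I') I' Prod.snd p X) (mfderiv (I.prod I') I' Prod.snd p Y) := rfl

theorem prodMetric_apply' (g : BilinField I M) (g' : BilinField I' M') (p : M × M')
    (X Y : TangentSpace I p.1) (X' Y' : TangentSpace I' p.2) :
    prodMetric g g' p ((X, X') : E × E') ((Y, Y') : E × E') = g p.1 X Y + g' p.2 X' Y' := by
  refine (prodMetric_apply g g' p _ _).trans ?_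
  rw [mfderiv_fst, mfderiv_snd]
  rfl

theorem metricMatrix_prod [I.Boundaryless] [IsManifold I 1 M] [I'.Boundaryless]
    [IsManifold I' 1 M'] (b : Module.Basis ι ℝ E) (b' : Module.Basis ι' ℝ E')
    (g : BilinField I M) (g' : BilinField I' M') (p : M × M')
    {z : E × E'} (hz₁ : z.1 ∈ (extChartAt I p.1).target)
    (hz₂ : z.2 ∈ (extChartAt I' p.2).target) :
    metricMatrix (I.prod I') (b.prod b') (prodMetric g g') p z
      = Matrix.fromBlocks (metricMatrix I b g p.1 z.1) 0 0 (metricMatrix I' b' g' p.2 z.2) := by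
  have f₁ := mfderiv_fst_coordVec_inl b b' p hz₁ hz₂
  have f₂ := mfderiv_fst_coordVec_inr b b' p hz₁ hz₂
  have f₃ := mfderiv_snd_coordVec_inl b b' p hz₁ hz₂
  have f₄ := mfderiv_snd_coordVec_inr b b' p hz₁ hz₂
  ext (i | i) (j | j) <;> rw [metricMatrix, Matrix.of_apply, prodMetric_apply]
  · rw [f₁, f₁, f₃, f₃, map_zero, add_zero]
    rfl
  · rw [f₁, f₂, f₃, f₄, map_zero, map_zero]
    exact add_zero (0 : ℝ)
  · rw [f₁, f₂, f₃, f₄, map_zero, map_zero]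
    exact zero_add (0 : ℝ)
  · rw [f₂, f₂, f₄, f₄, map_zero, zero_add]
    rfl

/-- The Ricci tensor of a product metric restricts to the Ricci tensors of the factors. -/
theorem ricci_prodMetric [Fintype ι] [DecidableEq ι] [Fintype ι'] [DecidableEq ι']
    [I.Boundaryless] [IsManifold I 1 M] [I'.Boundaryless] [IsManifold I' 1 M']
    [Nonempty ι] [Nonempty ι'] (b : Module.Basis ι ℝ E)
    (b' : Module.Basis ι' ℝ E')
    (g : BilinField I M) (g' : BilinField I' M')
    (hg : ∀ x X, (∀ Y, g x X Y = 0) → X = 0) (hg' : ∀ x X, (∀ Y, g' x X Y = 0) → X = 0)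
    (p : M × M') :
    (∀ X Y : TangentSpace I p.1, ricci (I.prod I') (b.prod b') (prodMetric g g') p
      ((X, 0) : E × E') ((Y, 0) : E × E') = ricci I b g p.1 X Y) ∧
    (∀ X Y : TangentSpace I' p.2, ricci (I.prod I') (b.prod b') (prodMetric g g') p
      ((0, X) : E × E') ((0, Y) : E × E') = ricci I' b' g' p.2 X Y) := by
  have hS : IsOpen ((extChartAt I p.1).target ×ˢ (extChartAt I' p.2).target) :=
    (isOpen_extChartAt_target p.1).prod (isOpen_extChartAt_target p.2)
  have hp : extChartAt (I.prod I') p p ∈ (extChartAt I p.1).target ×ˢ (extChartAt I' p.2).target :=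
    ⟨mem_extChartAt_target p.1, mem_extChartAt_target p.2⟩
  have h := localRicci_block b b' (G := metricMatrix (I.prod I') (b.prod b') (prodMetric g g') p)
    (G₁ := metricMatrix I b g p.1) (G₂ := metricMatrix I' b' g' p.2) hS
    (fun z hz => metricMatrix_prod b b' g g' p hz.1 hz.2)
    (fun z hz => metricMatrix_isUnit b g hg hz.1) (fun z hz => metricMatrix_isUnit b' g' hg' hz.2)
    hp
  have hl (i j) : ricciCoord (I.prod I') (b.prod b') (prodMetric g g') p (Sum.inl i) (Sum.inl j)
      (extChartAt (I.prod I') p p) = ricciCoord I b g p.1 i j (extChartAt I p.1 p.1) := h.1 i j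
  have hr (i j) : ricciCoord (I.prod I') (b.prod b') (prodMetric g g') p (Sum.inr i) (Sum.inr j)
      (extChartAt (I.prod I') p p) = ricciCoord I' b' g' p.2 i j (extChartAt I' p.2 p.2) :=
    h.2 i j
  have e₁ (Z : TangentSpace I p.1) (a : ι ⊕ ι') :
      (b.prod b').repr (mfderiv (I.prod I') 𝓘(ℝ, E × E') (extChartAt (I.prod I') p) p
        ((Z, 0) : E × E')) a
        = Sum.elim (fun i => b.repr (mfderiv I 𝓘(ℝ, E) (extChartAt I p.1) p.1 Z) i)
          (fun _ => 0) a := by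
    have h' : mfderiv (I.prod I') 𝓘(ℝ, E × E') (extChartAt (I.prod I') p) p ((Z, 0) : E × E')
        = ((mfderiv I 𝓘(ℝ, E) (extChartAt I p.1) p.1 Z, 0) : E × E') :=
      (mfderiv_extChartAt_prod p Z 0).trans (Prod.ext rfl (map_zero _))
    refine (congrArg (fun v => (b.prod b').repr v a) h').trans ?_
    rcases a with a | a
    · exact b.prod_repr_inl b' _ a
    · exact (b.prod_repr_inr b' _ a).trans (by simp)
  have e₂ (Z : TangentSpace I' p.2) (a : ι ⊕ ι') :
      (b.prod b').repr (mfderiv (I.prod I') 𝓘(ℝ, E × E') (extChartAt (I.prod I') p) p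
        ((0, Z) : E × E')) a
        = Sum.elim (fun _ => 0)
          (fun i => b'.repr (mfderiv I' 𝓘(ℝ, E') (extChartAt I' p.2) p.2 Z) i) a := by
    have h' : mfderiv (I.prod I') 𝓘(ℝ, E × E') (extChartAt (I.prod I') p) p ((0, Z) : E × E')
        = ((0, mfderiv I' 𝓘(ℝ, E') (extChartAt I' p.2) p.2 Z) : E × E') :=
      (mfderiv_extChartAt_prod p 0 Z).trans (Prod.ext (map_zero _) rfl)
    refine (congrArg (fun v => (b.prod b').repr v a) h').trans ?_
    rcases a with a | a
    · exact (b.prod_repr_inl b' _ a).trans (by simp)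
    · exact b.prod_repr_inr b' _ a
  constructor
  · intro X Y
    refine (Finset.sum_congr rfl fun a _ => Finset.sum_congr rfl fun c _ =>
      congrArg₂ (· * ·) (congrArg₂ (· * ·) (e₁ X a) (e₁ Y c)) rfl).trans ?_
    simp only [Fintype.sum_sum_type, Sum.elim_inl, Sum.elim_inr, hl, mul_zero, zero_mul,
      Finset.sum_const_zero, add_zero]
    rfl
  · intro X Y
    refine (Finset.sum_congr rfl fun a _ => Finset.sum_congr rfl fun c _ =>
      congrArg₂ (· * ·) (congrArg₂ (· * ·) (e₂ X a) (e₂ Y c)) rfl).trans ?_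
    simp only [Fintype.sum_sum_type, Sum.elim_inl, Sum.elim_inr, hr, mul_zero, zero_mul,
      Finset.sum_const_zero, zero_add]
    rfl

end ManifoldRicci

section Contraction

variable {V W : Type*} [AddCommGroup V] [Module ℝ V] [AddCommGroup W] [Module ℝ W]
  {ι ι' : Type*} [Fintype ι] [Fintype ι'] (b : Module.Basis ι ℝ V) (b' : Module.Basis ι' ℝ W)
  (A : Matrix ι ι ℝ) (B : Matrix ι' ι' ℝ)

/-- The wedge product of two forms on the factors of a product. -/
noncomputable abbrev wedge₂ {k l : ℕ} (α : V [⋀^Fin k]→ₗ[ℝ] ℝ) (β : W [⋀^Fin l]→ₗ[ℝ] ℝ) :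
    (V × W) [⋀^Fin (k + l)]→ₗ[ℝ] ℝ :=
  wedge (α.compLinearMap (LinearMap.fst ℝ V W)) (β.compLinearMap (LinearMap.snd ℝ V W))

theorem pairing_wedge_fst {k l : ℕ} (γ : V [⋀^Fin (k + (l + 1))]→ₗ[ℝ] ℝ)
    (α : V [⋀^Fin k]→ₗ[ℝ] ℝ) (β : W [⋀^Fin (l + 1)]→ₗ[ℝ] ℝ) :
    pairing (b.prod b') (Matrix.fromBlocks A 0 0 B) (wedge₂ α β)
      (γ.compLinearMap (LinearMap.fst ℝ V W)) = 0 := by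
  rw [← pairing_transpose, Matrix.fromBlocks_transpose, Matrix.transpose_zero,
    Matrix.transpose_zero, pairing_fst_wedge]

theorem pairing_wedge_snd {k l : ℕ} (γ : W [⋀^Fin ((k + 1) + l)]→ₗ[ℝ] ℝ)
    (α : V [⋀^Fin (k + 1)]→ₗ[ℝ] ℝ) (β : W [⋀^Fin l]→ₗ[ℝ] ℝ) :
    pairing (b.prod b') (Matrix.fromBlocks A 0 0 B) (wedge₂ α β)
      (γ.compLinearMap (LinearMap.snd ℝ V W)) = 0 := by
  rw [← pairing_transpose, Matrix.fromBlocks_transpose, Matrix.transpose_zero,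
    Matrix.transpose_zero, pairing_snd_wedge]

theorem pairing_self_fst_add_wedge {k l : ℕ} (c : ℝ) (α : V [⋀^Fin (k + (l + 1))]→ₗ[ℝ] ℝ)
    (β : V [⋀^Fin k]→ₗ[ℝ] ℝ) (ν : W [⋀^Fin (l + 1)]→ₗ[ℝ] ℝ) :
    pairing (b.prod b') (Matrix.fromBlocks A 0 0 B)
      (c • α.compLinearMap (LinearMap.fst ℝ V W) + wedge₂ β ν)
      (c • α.compLinearMap (LinearMap.fst ℝ V W) + wedge₂ β ν)
      = c ^ 2 * pairing b A α α + pairing b A β β * pairing b' B ν ν := by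
  simp only [pairing_add_left, pairing_add_right, pairing_smul_left, pairing_smul_right]
  rw [pairing_fst, pairing_wedge_wedge, pairing_wedge_fst, pairing_fst_wedge]
  ring

theorem pairing_self_wedge_add_snd {k l : ℕ} (c : ℝ) (θ : W [⋀^Fin ((k + 1) + l)]→ₗ[ℝ] ℝ)
    (ϖ : V [⋀^Fin (k + 1)]→ₗ[ℝ] ℝ) (ε : W [⋀^Fin l]→ₗ[ℝ] ℝ) :
    pairing (b.prod b') (Matrix.fromBlocks A 0 0 B)
      (wedge₂ ϖ ε + c • θ.compLinearMap (LinearMap.snd ℝ V W))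
      (wedge₂ ϖ ε + c • θ.compLinearMap (LinearMap.snd ℝ V W))
      = pairing b A ϖ ϖ * pairing b' B ε ε + c ^ 2 * pairing b' B θ θ := by
  simp only [pairing_add_left, pairing_add_right, pairing_smul_left, pairing_smul_right]
  rw [pairing_snd, pairing_wedge_wedge, pairing_wedge_snd, pairing_snd_wedge]
  ring

theorem pairing_contract_fst_add_wedge {k l : ℕ} (c : ℝ) (α : V [⋀^Fin (k + (l + 1))]→ₗ[ℝ] ℝ)
    (β : V [⋀^Fin k]→ₗ[ℝ] ℝ) (ν : W [⋀^Fin (l + 1)]→ₗ[ℝ] ℝ) (X Y : W)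
    {F : (V × W) [⋀^Fin (k + l + 1)]→ₗ[ℝ] ℝ}
    (hF : F = c • α.compLinearMap (LinearMap.fst ℝ V W) + wedge₂ β ν) :
    pairing (b.prod b') (Matrix.fromBlocks A 0 0 B) (F.curryLeft (0, X)) (F.curryLeft (0, Y))
      = pairing b A β β * pairing b' B (ν.curryLeft X) (ν.curryLeft Y) := by
  refine pairing_curryLeft_inr b b' A B F X Y _ ?_
  have h := ((hasDerivAt_pairing b' B ν ν X Y).const_mul (pairing b A β β)).const_add
    (c ^ 2 * pairing b A α α)
  simp only [← pairing_self_fst_add_wedge b b'] at h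
  rw [hF]
  exact h

theorem pairing_contract_wedge_add_snd {n k l : ℕ} (c : ℝ) (θ : W [⋀^Fin ((k + 1) + l)]→ₗ[ℝ] ℝ)
    (ϖ : V [⋀^Fin (k + 1)]→ₗ[ℝ] ℝ) (ε : W [⋀^Fin l]→ₗ[ℝ] ℝ) (X Y : V) (hn : n + 1 = k + 1 + l)
    {F : (V × W) [⋀^Fin (n + 1)]→ₗ[ℝ] ℝ}
    (hF : F.domDomCongr (finCongr hn) = wedge₂ ϖ ε + c • θ.compLinearMap (LinearMap.snd ℝ V W)) :
    pairing (b.prod b') (Matrix.fromBlocks A 0 0 B) (F.curryLeft (X, 0)) (F.curryLeft (Y, 0))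
      = pairing b A (ϖ.curryLeft X) (ϖ.curryLeft Y) * pairing b' B ε ε := by
  refine pairing_curryLeft_inl b b' A B F X Y _ ?_
  have h := ((hasDerivAt_pairing b A ϖ ϖ X Y).mul_const (pairing b' B ε ε)).add_const
    (c ^ 2 * pairing b' B θ θ)
  simp only [← pairing_self_wedge_add_snd b b', ← hF] at h
  have hc {n m : ℕ} (hn : n = m) (F : (V × W) [⋀^Fin n]→ₗ[ℝ] ℝ) (C) :
      pairing (b.prod b') C (F.domDomCongr (finCongr hn)) (F.domDomCongr (finCongr hn))
        = pairing (b.prod b') C F F := by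
    subst hn
    rfl
  simpa only [hc] using h

end Contraction

section Einstein

variable {E E' : Type*} [NormedAddCommGroup E] [NormedSpace ℝ E]
  [NormedAddCommGroup E'] [NormedSpace ℝ E']
  {H H' : Type*} [TopologicalSpace H] [TopologicalSpace H']
  {I : ModelWithCorners ℝ E H} {I' : ModelWithCorners ℝ E' H'}
  {M M' : Type*} [TopologicalSpace M] [ChartedSpace H M]
  [TopologicalSpace M'] [ChartedSpace H' M']
  {ι ι' : Type*} [Fintype ι] [DecidableEq ι] [Fintype ι'] [DecidableEq ι']

theorem pullFst_eq {k : ℕ} (ζ : FormField I M k) (p : M × M') :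
    pullFst I' M' ζ p = (ζ p.1).compLinearMap (LinearMap.fst ℝ E E') := by
  rw [pullFst, mfderiv_fst]
  rfl

theorem pullSnd_eq {k : ℕ} (ζ : FormField I' M' k) (p : M × M') :
    pullSnd I M ζ p = (ζ p.2).compLinearMap (LinearMap.snd ℝ E E') := by
  rw [pullSnd, mfderiv_snd]
  rfl

theorem wedgeProd_eq {k l : ℕ} (ζ : FormField I M k) (η : FormField I' M' l) (p : M × M') :
    wedgeProd ζ η p = wedge₂ (V := E) (W := E') (ζ p.1) (η p.2) := by
  rw [wedgeProd, pullFst_eq, pullSnd_eq]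
  rfl

/-- The inverse Gram matrix of a metric in the basis of the model space. -/
noncomputable def invGram (I : ModelWithCorners ℝ E H) (b : Module.Basis ι ℝ E)
    (g : BilinField I M) (x : M) : Matrix ι ι ℝ :=
  (gram (tangentBasis I b x) (g x))⁻¹

theorem isUnit_gram_tangentBasis (b : Module.Basis ι ℝ E) (g : BilinField I M)
    (hg : ∀ x X, (∀ Y, g x X Y = 0) → X = 0) (x : M) :
    IsUnit (gram (tangentBasis I b x) (g x)) :=
  isUnit_gram _ _ (hg x)

theorem invGram_prod (b : Module.Basis ι ℝ E) (b' : Module.Basis ι' ℝ E') (g : BilinField I M)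
    (g' : BilinField I' M') (hg : ∀ x X, (∀ Y, g x X Y = 0) → X = 0)
    (hg' : ∀ x X, (∀ Y, g' x X Y = 0) → X = 0) (p : M × M') :
    invGram (I.prod I') (b.prod b') (prodMetric g g') p
      = Matrix.fromBlocks (invGram I b g p.1) 0 0 (invGram I' b' g' p.2) := by
  have h : gram (tangentBasis (I.prod I') (b.prod b') p) (prodMetric g g' p)
      = Matrix.fromBlocks (gram (tangentBasis I b p.1) (g p.1)) 0 0
        (gram (tangentBasis I' b' p.2) (g' p.2)) := by
    have hl (i : ι) : (b.prod b') (Sum.inl i) = (b i, 0) := by simp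
    have hr (i : ι') : (b.prod b') (Sum.inr i) = (0, b' i) := by simp
    ext a c
    refine (prodMetric_apply' g g' p (b.prod b' a).1 (b.prod b' c).1 (b.prod b' a).2
      (b.prod b' c).2).trans ?_
    rcases a with i | i <;> rcases c with j | j <;> simp only [hl, hr]
    · exact (congrArg (g p.1 (b i) (b j) + ·) (LinearMap.map_zero (g' p.2 0))).trans (add_zero _)
    · exact (congrArg₂ (· + ·) (LinearMap.map_zero (g p.1 (b i)))
        (LinearMap.map_zero₂ (g' p.2) (b' j))).trans (add_zero (0 : ℝ))
    · exact (congrArg₂ (· + ·) (LinearMap.map_zero₂ (g p.1) (b j))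
        (LinearMap.map_zero (g' p.2 (b' i)))).trans (add_zero (0 : ℝ))
    · exact (congrArg (· + g' p.2 (b' i) (b' j)) (LinearMap.map_zero (g p.1 0))).trans (zero_add _)
  rw [invGram, h, Matrix.inv_fromBlocks_zero₂₁_of_isUnit_iff _ _ _
    (iff_of_true (isUnit_gram_tangentBasis b g hg p.1) (isUnit_gram_tangentBasis b' g' hg' p.2))]
  simp [invGram]

variable [I.Boundaryless] [IsManifold I 1 M] [I'.Boundaryless] [IsManifold I' 1 M']
  [Nonempty ι] [Nonempty ι']

theorem SupergravityEinstein.ricci_fst (b : Module.Basis ι ℝ E) (b' : Module.Basis ι' ℝ E')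
    {g : BilinField I M} {g' : BilinField I' M'} (hg : ∀ x X, (∀ Y, g x X Y = 0) → X = 0)
    (hg' : ∀ x X, (∀ Y, g' x X Y = 0) → X = 0) {F : FormField (I.prod I') (M × M') 4}
    (hF : SupergravityEinstein (I.prod I') (b.prod b') (prodMetric g g') F) (p : M × M')
    {Φ : (E × E') [⋀^Fin 4]→ₗ[ℝ] ℝ} (hΦ : F p = Φ)
    (X Y : TangentSpace I p.1) :
    ricci I b g p.1 X Y = -(1 / 2) * pairing (b.prod b')
        (Matrix.fromBlocks (invGram I b g p.1) 0 0 (invGram I' b' g' p.2))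
        (Φ.curryLeft (X, 0)) (Φ.curryLeft (Y, 0))
      + (1 / 6) * g p.1 X Y * pairing (b.prod b')
        (Matrix.fromBlocks (invGram I b g p.1) 0 0 (invGram I' b' g' p.2)) Φ Φ := by
  subst hΦ
  have h := hF p ((X, 0) : E × E') ((Y, 0) : E × E')
  rw [← (ricci_prodMetric b b' g g' hg hg' p).1 X Y, ← invGram_prod b b' g g' hg hg' p]
  refine h.trans ?_
  have h' : prodMetric g g' p ((X, 0) : E × E') ((Y, 0) : E × E') = g p.1 X Y :=
    (prodMetric_apply' g g' p X Y 0 0).trans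
      ((congrArg (g p.1 X Y + ·) (LinearMap.map_zero (g' p.2 0))).trans (add_zero _))
  rw [h']
  rfl

theorem SupergravityEinstein.ricci_snd (b : Module.Basis ι ℝ E) (b' : Module.Basis ι' ℝ E')
    {g : BilinField I M} {g' : BilinField I' M'} (hg : ∀ x X, (∀ Y, g x X Y = 0) → X = 0)
    (hg' : ∀ x X, (∀ Y, g' x X Y = 0) → X = 0) {F : FormField (I.prod I') (M × M') 4}
    (hF : SupergravityEinstein (I.prod I') (b.prod b') (prodMetric g g') F) (p : M × M')
    {Φ : (E × E') [⋀^Fin 4]→ₗ[ℝ] ℝ} (hΦ : F p = Φ)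
    (X Y : TangentSpace I' p.2) :
    ricci I' b' g' p.2 X Y = -(1 / 2) * pairing (b.prod b')
        (Matrix.fromBlocks (invGram I b g p.1) 0 0 (invGram I' b' g' p.2))
        (Φ.curryLeft (0, X)) (Φ.curryLeft (0, Y))
      + (1 / 6) * g' p.2 X Y * pairing (b.prod b')
        (Matrix.fromBlocks (invGram I b g p.1) 0 0 (invGram I' b' g' p.2)) Φ Φ := by
  subst hΦ
  have h := hF p ((0, X) : E × E') ((0, Y) : E × E')
  rw [← (ricci_prodMetric b b' g g' hg hg' p).2 X Y, ← invGram_prod b b' g g' hg hg' p]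
  refine h.trans ?_
  have h' : prodMetric g g' p ((0, X) : E × E') ((0, Y) : E × E') = g' p.2 X Y :=
    (prodMetric_apply' g g' p 0 0 X Y).trans
      ((congrArg (· + g' p.2 X Y) (LinearMap.map_zero (g p.1 0))).trans (zero_add _))
  rw [h']
  rfl

end Einstein

section DegreeFour

variable {V W : Type*} [AddCommGroup V] [Module ℝ V] [AddCommGroup W] [Module ℝ W]
  {ι ι' : Type*} [Fintype ι] [Fintype ι'] (b : Module.Basis ι ℝ V) (b' : Module.Basis ι' ℝ W)
  (A : Matrix ι ι ℝ) (B : Matrix ι' ι' ℝ) {Φ : (V × W) [⋀^Fin 4]→ₗ[ℝ] ℝ}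

theorem pairing_contract_fst {k : ℕ} (α : V [⋀^Fin (k + 1)]→ₗ[ℝ] ℝ) (X Y : W) :
    pairing (b.prod b') (Matrix.fromBlocks A 0 0 B)
      ((α.compLinearMap (LinearMap.fst ℝ V W)).curryLeft (0, X))
      ((α.compLinearMap (LinearMap.fst ℝ V W)).curryLeft (0, Y)) = 0 := by
  refine pairing_curryLeft_inr b b' A B _ X Y 0 ?_
  simp only [pairing_fst]
  exact hasDerivAt_const _ _

theorem pairing_contract_snd {k : ℕ} (θ : W [⋀^Fin (k + 1)]→ₗ[ℝ] ℝ) (X Y : V) :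
    pairing (b.prod b') (Matrix.fromBlocks A 0 0 B)
      ((θ.compLinearMap (LinearMap.snd ℝ V W)).curryLeft (X, 0))
      ((θ.compLinearMap (LinearMap.snd ℝ V W)).curryLeft (Y, 0)) = 0 := by
  refine pairing_curryLeft_inl b b' A B _ X Y 0 ?_
  simp only [pairing_snd]
  exact hasDerivAt_const _ _

theorem pairing_curryLeft_one (ν μ : W [⋀^Fin 1]→ₗ[ℝ] ℝ) (X Y : W) :
    pairing b' B (ν.curryLeft X) (μ.curryLeft Y) = ν ![X] * μ ![Y] :=
  pairing_zero_forms b' B _ _ ![]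

theorem pairing_self_four_add_three_one (c : ℝ) (α : V [⋀^Fin 4]→ₗ[ℝ] ℝ)
    (β : V [⋀^Fin 3]→ₗ[ℝ] ℝ) (ν : W [⋀^Fin 1]→ₗ[ℝ] ℝ)
    (hΦ : Φ = c • α.compLinearMap (LinearMap.fst ℝ V W) + wedge₂ β ν) :
    pairing (b.prod b') (Matrix.fromBlocks A 0 0 B) Φ Φ
      = c ^ 2 * pairing b A α α + pairing b A β β * pairing b' B ν ν := by
  subst hΦ
  exact pairing_self_fst_add_wedge (k := 3) (l := 0) b b' A B c α β ν

theorem pairing_contract_four_add_three_one (c : ℝ) (α : V [⋀^Fin 4]→ₗ[ℝ] ℝ)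
    (β : V [⋀^Fin 3]→ₗ[ℝ] ℝ) (ν : W [⋀^Fin 1]→ₗ[ℝ] ℝ) (X Y : W)
    (hΦ : Φ = c • α.compLinearMap (LinearMap.fst ℝ V W) + wedge₂ β ν) :
    pairing (b.prod b') (Matrix.fromBlocks A 0 0 B) (Φ.curryLeft (0, X)) (Φ.curryLeft (0, Y))
      = pairing b A β β * (ν ![X] * ν ![Y]) := by
  rw [← pairing_curryLeft_one b' B]
  exact pairing_contract_fst_add_wedge (k := 3) (l := 0) b b' A B c α β ν X Y hΦ

theorem pairing_self_one_three_add_four (c : ℝ) (θ : W [⋀^Fin 4]→ₗ[ℝ] ℝ)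
    (ϖ : V [⋀^Fin 1]→ₗ[ℝ] ℝ) (ε : W [⋀^Fin 3]→ₗ[ℝ] ℝ)
    (hΦ : Φ = (wedge₂ ϖ ε : (V × W) [⋀^Fin 4]→ₗ[ℝ] ℝ)
      + c • θ.compLinearMap (LinearMap.snd ℝ V W)) :
    pairing (b.prod b') (Matrix.fromBlocks A 0 0 B) Φ Φ
      = pairing b A ϖ ϖ * pairing b' B ε ε + c ^ 2 * pairing b' B θ θ := by
  subst hΦ
  exact pairing_self_wedge_add_snd (k := 0) (l := 3) b b' A B c θ ϖ ε

theorem pairing_contract_one_three_add_four (c : ℝ) (θ : W [⋀^Fin 4]→ₗ[ℝ] ℝ)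
    (ϖ : V [⋀^Fin 1]→ₗ[ℝ] ℝ) (ε : W [⋀^Fin 3]→ₗ[ℝ] ℝ) (X Y : V)
    (hΦ : Φ = (wedge₂ ϖ ε : (V × W) [⋀^Fin 4]→ₗ[ℝ] ℝ)
      + c • θ.compLinearMap (LinearMap.snd ℝ V W)) :
    pairing (b.prod b') (Matrix.fromBlocks A 0 0 B) (Φ.curryLeft (X, 0)) (Φ.curryLeft (Y, 0))
      = (ϖ ![X] * ϖ ![Y]) * pairing b' B ε ε := by
  rw [← pairing_curryLeft_one b A]
  exact pairing_contract_wedge_add_snd (n := 3) (k := 0) (l := 3) b b' A B c θ ϖ ε X Y rfl hΦ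

theorem pairing_contract_two_two_snd (γ : V [⋀^Fin 2]→ₗ[ℝ] ℝ) (δ : W [⋀^Fin 2]→ₗ[ℝ] ℝ)
    (X Y : W) (hΦ : Φ = wedge₂ γ δ) :
    pairing (b.prod b') (Matrix.fromBlocks A 0 0 B) (Φ.curryLeft (0, X)) (Φ.curryLeft (0, Y))
      = pairing b A γ γ * pairing b' B (δ.curryLeft X) (δ.curryLeft Y) := by
  refine pairing_contract_fst_add_wedge (k := 2) (l := 1) b b' A B 0 0 γ δ X Y ?_
  rw [zero_smul, zero_add]
  exact hΦ

theorem pairing_contract_two_two_fst (γ : V [⋀^Fin 2]→ₗ[ℝ] ℝ) (δ : W [⋀^Fin 2]→ₗ[ℝ] ℝ)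
    (X Y : V) (hΦ : Φ = wedge₂ γ δ) :
    pairing (b.prod b') (Matrix.fromBlocks A 0 0 B) (Φ.curryLeft (X, 0)) (Φ.curryLeft (Y, 0))
      = pairing b A (γ.curryLeft X) (γ.curryLeft Y) * pairing b' B δ δ := by
  refine pairing_contract_wedge_add_snd (n := 3) (k := 1) (l := 2) b b' A B 0 0 γ δ X Y rfl ?_
  rw [zero_smul, add_zero]
  exact hΦ

end DegreeFour

section Formulas

variable {E E' : Type*} [NormedAddCommGroup E] [NormedSpace ℝ E]
  [NormedAddCommGroup E'] [NormedSpace ℝ E']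
  {H H' : Type*} [TopologicalSpace H] [TopologicalSpace H']
  {I : ModelWithCorners ℝ E H} {I' : ModelWithCorners ℝ E' H'}
  {M M' : Type*} [TopologicalSpace M] [ChartedSpace H M]
  [TopologicalSpace M'] [ChartedSpace H' M']
  {ι ι' : Type*} [Fintype ι] [DecidableEq ι] [Fintype ι'] [DecidableEq ι']
  [I.Boundaryless] [IsManifold I 1 M] [I'.Boundaryless] [IsManifold I' 1 M']
  [Nonempty ι] [Nonempty ι']
  {b : Module.Basis ι ℝ E} {b' : Module.Basis ι' ℝ E'} {g : BilinField I M} {g' : BilinField I' M'}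
  {F : FormField (I.prod I') (M × M') 4}

theorem SupergravityEinstein.ricci_snd_of_pullFst (hg : ∀ x X, (∀ Y, g x X Y = 0) → X = 0)
    (hg' : ∀ x X, (∀ Y, g' x X Y = 0) → X = 0)
    (hE : SupergravityEinstein (I.prod I') (b.prod b') (prodMetric g g') F)
    {α : FormField I M 4} (hF : F = pullFst I' M' α) (x : M) (y : M')
    (X Y : TangentSpace I' y) :
    ricci I' b' g' y X Y = (1 / 6) * g' y X Y * normSq I b g α x := by
  let a : E [⋀^Fin 4]→ₗ[ℝ] ℝ := α x
  have hΦ : F (x, y) = a.compLinearMap (LinearMap.fst ℝ E E') := by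
    rw [hF]
    exact pullFst_eq α (x, y)
  have h := SupergravityEinstein.ricci_snd b b' hg hg' hE (x, y) hΦ X Y
  rw [pairing_fst, pairing_contract_fst (k := 3) b b' _ _ a X Y, mul_zero, zero_add] at h
  exact h

theorem SupergravityEinstein.ricci_fst_of_pullSnd (hg : ∀ x X, (∀ Y, g x X Y = 0) → X = 0)
    (hg' : ∀ x X, (∀ Y, g' x X Y = 0) → X = 0)
    (hE : SupergravityEinstein (I.prod I') (b.prod b') (prodMetric g g') F)
    {θ : FormField I' M' 4} (hF : F = pullSnd I M θ) (x : M) (y : M')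
    (X Y : TangentSpace I x) :
    ricci I b g x X Y = (1 / 6) * g x X Y * normSq I' b' g' θ y := by
  let t : E' [⋀^Fin 4]→ₗ[ℝ] ℝ := θ y
  have hΦ : F (x, y) = t.compLinearMap (LinearMap.snd ℝ E E') := by
    rw [hF]
    exact pullSnd_eq θ (x, y)
  have h := SupergravityEinstein.ricci_fst b b' hg hg' hE (x, y) hΦ X Y
  rw [pairing_snd, pairing_contract_snd (k := 3) b b' _ _ t X Y, mul_zero, zero_add] at h
  exact h

theorem SupergravityEinstein.ricci_snd_of_add (hg : ∀ x X, (∀ Y, g x X Y = 0) → X = 0)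
    (hg' : ∀ x X, (∀ Y, g' x X Y = 0) → X = 0)
    (hE : SupergravityEinstein (I.prod I') (b.prod b') (prodMetric g g') F)
    {φ : M' → ℝ} {α : FormField I M 4} {β : FormField I M 3} {ν : FormField I' M' 1}
    (hF : F = fun p => φ p.2 • pullFst I' M' α p + wedgeProd β ν p) (x : M) (y : M')
    (X Y : TangentSpace I' y) :
    ricci I' b' g' y X Y = -(1 / 2) * (normSq I b g β x * (ν y ![X] * ν y ![Y]))
      + (1 / 6) * g' y X Y *
        (φ y ^ 2 * normSq I b g α x + normSq I b g β x * normSq I' b' g' ν y) := by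
  let a : E [⋀^Fin 4]→ₗ[ℝ] ℝ := α x
  let β' : E [⋀^Fin 3]→ₗ[ℝ] ℝ := β x
  let n : E' [⋀^Fin 1]→ₗ[ℝ] ℝ := ν y
  let Φ : (E × E') [⋀^Fin 4]→ₗ[ℝ] ℝ :=
    φ y • a.compLinearMap (LinearMap.fst ℝ E E') + wedge₂ β' n
  have hΦ : F (x, y) = Φ := by
    rw [hF]
    exact congrArg₂ (fun p q : (E × E') [⋀^Fin 4]→ₗ[ℝ] ℝ => φ y • p + q) (pullFst_eq α (x, y))
      (wedgeProd_eq β ν (x, y))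
  have h := SupergravityEinstein.ricci_snd b b' hg hg' hE (x, y) hΦ X Y
  rw [pairing_contract_four_add_three_one b b' _ _ (φ y) a β' n X Y rfl,
    pairing_self_four_add_three_one b b' _ _ (φ y) a β' n rfl] at h
  exact h

theorem SupergravityEinstein.ricci_fst_of_add (hg : ∀ x X, (∀ Y, g x X Y = 0) → X = 0)
    (hg' : ∀ x X, (∀ Y, g' x X Y = 0) → X = 0)
    (hE : SupergravityEinstein (I.prod I') (b.prod b') (prodMetric g g') F)
    {ϖ : FormField I M 1} {ε : FormField I' M' 3} {ψ : M → ℝ} {θ : FormField I' M' 4}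
    (hF : F = fun p => wedgeProd ϖ ε p + ψ p.1 • pullSnd I M θ p) (x : M) (y : M')
    (X Y : TangentSpace I x) :
    ricci I b g x X Y = -(1 / 2) * ((ϖ x ![X] * ϖ x ![Y]) * normSq I' b' g' ε y)
      + (1 / 6) * g x X Y *
        (normSq I b g ϖ x * normSq I' b' g' ε y + ψ x ^ 2 * normSq I' b' g' θ y) := by
  let t : E' [⋀^Fin 4]→ₗ[ℝ] ℝ := θ y
  let w : E [⋀^Fin 1]→ₗ[ℝ] ℝ := ϖ x
  let e : E' [⋀^Fin 3]→ₗ[ℝ] ℝ := ε y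
  let Φ : (E × E') [⋀^Fin 4]→ₗ[ℝ] ℝ :=
    (wedge₂ w e : (E × E') [⋀^Fin 4]→ₗ[ℝ] ℝ) + ψ x • t.compLinearMap (LinearMap.snd ℝ E E')
  have hΦ : F (x, y) = Φ := by
    rw [hF]
    exact congrArg₂ (fun p q : (E × E') [⋀^Fin 4]→ₗ[ℝ] ℝ => p + ψ x • q)
      (wedgeProd_eq ϖ ε (x, y)) (pullSnd_eq θ (x, y))
  have h := SupergravityEinstein.ricci_fst b b' hg hg' hE (x, y) hΦ X Y
  rw [pairing_contract_one_three_add_four b b' _ _ (ψ x) t w e X Y rfl,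
    pairing_self_one_three_add_four b b' _ _ (ψ x) t w e rfl] at h
  exact h

theorem SupergravityEinstein.ricci_of_two_two (hg : ∀ x X, (∀ Y, g x X Y = 0) → X = 0)
    (hg' : ∀ x X, (∀ Y, g' x X Y = 0) → X = 0)
    (hE : SupergravityEinstein (I.prod I') (b.prod b') (prodMetric g g') F)
    {γ : FormField I M 2} {δ : FormField I' M' 2} (hF : F = wedgeProd γ δ) (x : M) (y : M') :
    (∀ X Y, ricci I b g x X Y = normSq I' b' g' δ y *
      (-(1 / 2) * innerAt I b g x ((γ x).curryLeft X) ((γ x).curryLeft Y)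
        + (1 / 6) * g x X Y * normSq I b g γ x)) ∧
    (∀ X Y, ricci I' b' g' y X Y = normSq I b g γ x *
      (-(1 / 2) * innerAt I' b' g' y ((δ y).curryLeft X) ((δ y).curryLeft Y)
        + (1 / 6) * g' y X Y * normSq I' b' g' δ y)) := by
  let c : E [⋀^Fin 2]→ₗ[ℝ] ℝ := γ x
  let d : E' [⋀^Fin 2]→ₗ[ℝ] ℝ := δ y
  let Φ : (E × E') [⋀^Fin 4]→ₗ[ℝ] ℝ := wedge₂ c d
  have hΦ : F (x, y) = Φ := by
    rw [hF]
    exact wedgeProd_eq γ δ (x, y)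
  have hself := pairing_wedge_wedge b b' (invGram I b g x) (invGram I' b' g' y) c c d d
  constructor
  · intro X Y
    have h := SupergravityEinstein.ricci_fst b b' hg hg' hE (x, y) hΦ X Y
    rw [pairing_contract_two_two_fst b b' _ _ c d X Y rfl] at h
    refine (h.trans (congrArg (_ + _ * ·) hself)).trans ?_
    change -(1 / 2) * (innerAt I b g x ((γ x).curryLeft X) ((γ x).curryLeft Y)
        * normSq I' b' g' δ y)
      + 1 / 6 * g x X Y * (normSq I b g γ x * normSq I' b' g' δ y) = _
    ring
  · intro X Y
    have h := SupergravityEinstein.ricci_snd b b' hg hg' hE (x, y) hΦ X Y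
    rw [pairing_contract_two_two_snd b b' _ _ c d X Y rfl] at h
    refine (h.trans (congrArg (_ + _ * ·) hself)).trans ?_
    change -(1 / 2) * (normSq I b g γ x
        * innerAt I' b' g' y ((δ y).curryLeft X) ((δ y).curryLeft Y))
      + 1 / 6 * g' y X Y * (normSq I b g γ x * normSq I' b' g' δ y) = _
    ring

end Formulas

section Smoothness

variable {E : Type*} [NormedAddCommGroup E] [NormedSpace ℝ E] {ι : Type*} [Fintype ι]
  [DecidableEq ι]

theorem contDiffOn_det {G : E → Matrix ι ι ℝ} {S : Set E} {n : ℕ∞ω}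
    (hG : ∀ i j, ContDiffOn ℝ n (fun y => G y i j) S) : ContDiffOn ℝ n (fun y => (G y).det) S := by
  simp only [Matrix.det_apply']
  exact ContDiffOn.sum fun σ _ => contDiffOn_const.mul (contDiffOn_prod fun i _ => hG _ _)

theorem contDiffOn_matrix_inv {G : E → Matrix ι ι ℝ} {S : Set E} {n : ℕ∞ω}
    (hG : ∀ i j, ContDiffOn ℝ n (fun y => G y i j) S) (hu : ∀ y ∈ S, IsUnit (G y)) (i j : ι) :
    ContDiffOn ℝ n (fun y => (G y)⁻¹ i j) S := by
  have h : ∀ y, (G y)⁻¹ i j = (G y).det⁻¹ * ((G y).updateRow j (Pi.single i 1)).det := fun y => by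
    rw [Matrix.inv_def, Ring.inverse_eq_inv', Matrix.smul_apply, Matrix.adjugate_apply, smul_eq_mul]
  simp only [h]
  refine (contDiffOn_det hG |>.inv fun y hy => ?_).mul (contDiffOn_det fun k l => ?_)
  · exact ((Matrix.isUnit_iff_isUnit_det _).1 (hu y hy)).ne_zero
  · by_cases hk : k = j
    · subst hk
      simp only [Matrix.updateRow_self]
      exact contDiffOn_const
    · simp only [Matrix.updateRow_ne hk]
      exact hG k l

variable {H : Type*} [TopologicalSpace H] {I : ModelWithCorners ℝ E H}
  {M : Type*} [TopologicalSpace M] [ChartedSpace H M] [I.Boundaryless] [IsManifold I 1 M]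

/-- An endomorphism field that represents a smooth two-form with respect to a smooth nondegenerate
metric is smooth. -/
theorem IsSmoothForm.isSmoothEnd {b : Module.Basis ι ℝ E} {g : BilinField I M}
    (hs : IsSmoothBilin I b g) (hg : ∀ x X, (∀ Y, g x X Y = 0) → X = 0) {ζ : FormField I M 2}
    (hζ : IsSmoothForm I b ζ) {J : EndField I M} (hJ : ∀ x X Y, ζ x ![X, Y] = g x (J x X) Y) :
    IsSmoothEnd I b J := by
  intro x₀ i j
  have hinv (k : ι) := contDiffOn_matrix_inv (hs x₀)
    (fun y hy => metricMatrix_isUnit b g hg hy) k j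
  have hsum : ContDiffOn ℝ ∞ (fun y => ∑ k, ζ ((extChartAt I x₀).symm y)
      (fun a => coordVec I b x₀ y ((![i, k] : Fin 2 → ι) a)) * (metricMatrix I b g x₀ y)⁻¹ k j)
      (extChartAt I x₀).target :=
    ContDiffOn.sum fun k _ => (hζ x₀ ![i, k]).mul (hinv k)
  refine hsum.congr fun y hy => ?_
  obtain ⟨c, hc⟩ := exists_basis_coordVec (I := I) b hy
  have hu := (Matrix.isUnit_iff_isUnit_det _).1 (metricMatrix_isUnit b g hg hy)
  have hgram : gram c (g ((extChartAt I x₀).symm y)) = metricMatrix I b g x₀ y := by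
    ext i j
    rw [gram, metricMatrix, Matrix.of_apply, Matrix.of_apply, hc, hc]
  have hrepr (v : TangentSpace I ((extChartAt I x₀).symm y)) :
      b.repr (mfderiv I 𝓘(ℝ, E) (extChartAt I x₀) ((extChartAt I x₀).symm y) v) j
        = c.repr v j := by
    let L : TangentSpace I ((extChartAt I x₀).symm y) →ₗ[ℝ] ℝ := b.coord j ∘ₗ
      (mfderiv I 𝓘(ℝ, E) (extChartAt I x₀) ((extChartAt I x₀).symm y)).toLinearMap
    have hL : L = c.coord j := c.ext fun m => by
      have h1 : L (c m) = b.repr (b m) j := by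
        rw [← mfderiv_extChartAt_coordVec b hy m, hc]
        rfl
      rw [h1, b.repr_self, c.coord_apply, c.repr_self]
    exact congrArg (fun f => f v) hL
  refine (hrepr _).trans ?_
  set v := J ((extChartAt I x₀).symm y) (coordVec I b x₀ y i)
  have hv : (fun k => ζ ((extChartAt I x₀).symm y)
      (fun a => coordVec I b x₀ y ((![i, k] : Fin 2 → ι) a)))
      = Matrix.vecMul (c.repr v) (metricMatrix I b g x₀ y) := by
    funext k
    rw [← hgram, gram_vecMul, hc, ← hJ]
    congr 1
    funext a
    fin_cases a <;> rfl
  have h2 : c.repr v = Matrix.vecMul (fun k => ζ ((extChartAt I x₀).symm y)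
      (fun a => coordVec I b x₀ y ((![i, k] : Fin 2 → ι) a))) (metricMatrix I b g x₀ y)⁻¹ := by
    rw [hv, Matrix.vecMul_vecMul, Matrix.mul_nonsing_inv _ hu, Matrix.vecMul_one]
  exact congrFun h2 j

end Smoothness

section Pointwise

variable {V : Type*} [AddCommGroup V] [Module ℝ V]

/-- A one-form as a linear functional. -/
def oneFormFunctional (ν : V [⋀^Fin 1]→ₗ[ℝ] ℝ) : V →ₗ[ℝ] ℝ where
  toFun X := ν ![X]
  map_add' := ν.map_vecCons_add ![]
  map_smul' := ν.map_vecCons_smul ![]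

theorem oneFormFunctional_ne_zero {ν : V [⋀^Fin 1]→ₗ[ℝ] ℝ} (hν : ν ≠ 0) :
    oneFormFunctional ν ≠ 0 := fun h => hν <| AlternatingMap.ext fun v => by
  have : v = ![v 0] := by
    funext a
    rw [Subsingleton.elim a 0]
    rfl
  rw [this]
  exact congrArg (fun f => f (v 0)) h

theorem two_form_swap (ζ : V [⋀^Fin 2]→ₗ[ℝ] ℝ) (X Y : V) : ζ ![X, Y] = -ζ ![Y, X] := by
  have := ζ.map_swap ![Y, X] (i := 0) (j := 1) (by decide)
  rw [← this]
  congr 1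
  funext a
  fin_cases a <;> rfl

/-- If the metric equals `⟨X ⌟ ζ, Y ⌟ ζ⟩` for a two-form `ζ`, then the endomorphism that
represents `ζ` is a compatible complex structure. -/
theorem complex_structure_of_pairing {ι : Type*} [Fintype ι] [DecidableEq ι]
    (b : Module.Basis ι ℝ V) (B : V →ₗ[ℝ] V →ₗ[ℝ] ℝ) (hs : ∀ X Y, B X Y = B Y X)
    (hB : ∀ X, (∀ Y, B X Y = 0) → X = 0) (ζ : V [⋀^Fin 2]→ₗ[ℝ] ℝ) (J : V →ₗ[ℝ] V)
    (hJ : ∀ X Y, ζ ![X, Y] = B (J X) Y)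
    (hζ : ∀ X Y, pairing b (gram b B)⁻¹ (ζ.curryLeft X) (ζ.curryLeft Y) = B X Y) :
    (∀ X, J (J X) = -X) ∧ ∀ X Y, B (J X) (J Y) = B X Y := by
  have hv (X : V) (v : Fin 1 → V) : ζ.curryLeft X v = B (J X) (v 0) := by
    rw [← hJ]
    change ζ _ = _
    congr 1
    funext a
    fin_cases a <;> rfl
  have hcompat (X Y : V) : B (J X) (J Y) = B X Y :=
    (hs _ _).trans ((pairing_one_forms b B (isUnit_gram b B hB) _ _ _ _ (hv X) (hv Y)).symm.trans
      (hζ X Y))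
  refine ⟨fun X => ?_, hcompat⟩
  refine eq_neg_of_add_eq_zero_left (hB _ fun Y => ?_)
  rw [map_add, LinearMap.add_apply, ← hJ, two_form_swap, hJ, hcompat, hs Y X, neg_add_cancel]

end Pointwise

section Parts

variable {E E' : Type*} [NormedAddCommGroup E] [NormedSpace ℝ E]
  [NormedAddCommGroup E'] [NormedSpace ℝ E']
  {H H' : Type*} [TopologicalSpace H] [TopologicalSpace H']
  {I : ModelWithCorners ℝ E H} {I' : ModelWithCorners ℝ E' H'}
  {M M' : Type*} [TopologicalSpace M] [ChartedSpace H M]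
  [TopologicalSpace M'] [ChartedSpace H' M']
  {ι' : Type*} {n : ℕ}
  {b : Module.Basis (Fin (n + 1)) ℝ E} {b' : Module.Basis ι' ℝ E'} {g : BilinField I M}
  {g' : BilinField I' M'}

theorem IsLorentzian.nondegenerate (hg : IsLorentzian I b g) (x : M) (X : TangentSpace I x)
    (h : ∀ Y, g x X Y = 0) : X = 0 := by
  obtain ⟨e, he⟩ := hg.orthonormal_basis x
  exact lorentz_nondegenerate (g x) e he X h

theorem IsLorentzian.symm (hg : IsLorentzian I b g) (x : M) (X Y : TangentSpace I x) :
    g x X Y = g x Y X := by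
  obtain ⟨e, he⟩ := hg.orthonormal_basis x
  exact lorentz_symm (g x) e he X Y

theorem IsNegRiemannian.nondegenerate (hg : IsNegRiemannian I' b' g') (x : M')
    (X : TangentSpace I' x) (h : ∀ Y, g' x X Y = 0) : X = 0 := by
  by_contra hX
  exact (hg.neg x X hX).ne (h X)

theorem IsNegRiemannian.normSq_pos [Fintype ι'] [DecidableEq ι'] (hg : IsNegRiemannian I' b' g')
    {k : ℕ} (ζ : FormField I' M' k) (x : M') (hζ : ζ x ≠ 0) :
    0 < (-1) ^ k * normSq I' b' g' ζ x :=
  pairing_self_pos (tangentBasis I' b' x) _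
    (neg_gram_inv_posDef _ _ (hg.symm x) (hg.neg x)) (ζ x) hζ

/-- Two orthogonal tangent vectors on which a nonzero one-form does not vanish. -/
theorem IsNegRiemannian.exists_orthogonal [Fintype ι'] (hg' : IsNegRiemannian I' b' g')
    (hdim : 1 < Fintype.card ι') {ν : FormField I' M' 1} {y : M'} (hν : ν y ≠ 0) :
    ∃ X Y, g' y X Y = 0 ∧ ν y ![X] ≠ 0 ∧ ν y ![Y] ≠ 0 :=
  exists_orthogonal_vectors (g' y) (hg'.neg y) (hg'.symm y)
    (by rwa [Module.finrank_eq_card_basis (tangentBasis I' b' y)])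
    (oneFormFunctional (ν y)) (oneFormFunctional_ne_zero hν)

/-- A null vector on which a nonzero one-form does not vanish. -/
theorem IsLorentzian.exists_null (hn : n ≠ 0) (hg : IsLorentzian I b g) {ϖ : FormField I M 1}
    {x : M} (hϖ : ϖ x ≠ 0) : ∃ X, g x X X = 0 ∧ ϖ x ![X] ≠ 0 := by
  obtain ⟨e, he⟩ := hg.orthonormal_basis x
  exact exists_null_vector hn (g x) e he (oneFormFunctional (ϖ x)) (oneFormFunctional_ne_zero hϖ)

variable [Fintype ι'] [DecidableEq ι'] [Nonempty ι']
  [I.Boundaryless] [IsManifold I 1 M] [I'.Boundaryless] [IsManifold I' 1 M'] {F : FormField (I.prod I') (M × M') 4}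

theorem einstein_of_pullFst [Nonempty M] [Nonempty M'] (hg : IsLorentzian I b g) (hg' : IsNegRiemannian I' b' g')
    (hE : SupergravityEinstein (I.prod I') (b.prod b') (prodMetric g g') F)
    {α : FormField I M 4} (hF : F = pullFst I' M' α) :
    ∃ c : ℝ, (∀ x, normSq I b g α x = c) ∧ IsEinstein I' b' g' (c / 6) := by
  have h := SupergravityEinstein.ricci_snd_of_pullFst hg.nondegenerate hg'.nondegenerate hE hF
  obtain ⟨x₀⟩ := ‹Nonempty M›
  obtain ⟨y₀⟩ := ‹Nonempty M'›
  obtain ⟨i⟩ := ‹Nonempty ι'›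
  refine ⟨normSq I b g α x₀, fun x => ?_, fun y X Y => ?_⟩
  · have hne := (hg'.neg y₀ (tangentBasis I' b' y₀ i) (Module.Basis.ne_zero _ i)).ne
    have := (h x y₀ _ _).symm.trans
      (h x₀ y₀ (tangentBasis I' b' y₀ i) (tangentBasis I' b' y₀ i))
    exact mul_left_cancel₀ (mul_ne_zero (by norm_num) hne) this
  · rw [h x₀ y X Y]
    ring

theorem einstein_of_pullSnd [Nonempty M] [Nonempty M'] (hg : IsLorentzian I b g) (hg' : IsNegRiemannian I' b' g')
    (hE : SupergravityEinstein (I.prod I') (b.prod b') (prodMetric g g') F)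
    {θ : FormField I' M' 4} (hF : F = pullSnd I M θ) :
    ∃ c : ℝ, (∀ y, normSq I' b' g' θ y = c) ∧ IsEinstein I b g (c / 6) ∧ (θ ≠ 0 → 0 < c / 6) := by
  have h := SupergravityEinstein.ricci_fst_of_pullSnd hg.nondegenerate hg'.nondegenerate hE hF
  obtain ⟨x₀⟩ := ‹Nonempty M›
  obtain ⟨y₀⟩ := ‹Nonempty M'›
  have hconst (y : M') : normSq I' b' g' θ y = normSq I' b' g' θ y₀ := by
    obtain ⟨e, he⟩ := hg.orthonormal_basis x₀
    have := (h x₀ y (e 0) (e 0)).symm.trans (h x₀ y₀ (e 0) (e 0))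
    exact mul_left_cancel₀ (mul_ne_zero (by norm_num) (by simp [he])) this
  refine ⟨normSq I' b' g' θ y₀, hconst, fun x X Y => ?_, fun hθ => ?_⟩
  · rw [h x y₀ X Y]
    ring
  · obtain ⟨y, hy⟩ := Function.ne_iff.1 hθ
    have := hg'.normSq_pos θ y hy
    rw [hconst] at this
    linarith

theorem normSq_const_of_fst_add [Nonempty M] (hdim : 1 < Fintype.card ι') (hg : IsLorentzian I b g)
    (hg' : IsNegRiemannian I' b' g')
    (hE : SupergravityEinstein (I.prod I') (b.prod b') (prodMetric g g') F)
    {φ : M' → ℝ} {α : FormField I M 4} {β : FormField I M 3} {ν : FormField I' M' 1}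
    (hF : F = fun p => φ p.2 • pullFst I' M' α p + wedgeProd β ν p) (hν : ν ≠ 0) :
    (∃ c : ℝ, ∀ x, normSq I b g β x = c) ∧
      (φ ≠ 0 → ∃ c : ℝ, ∀ x, normSq I b g α x = c) := by
  have h := SupergravityEinstein.ricci_snd_of_add hg.nondegenerate hg'.nondegenerate hE hF
  obtain ⟨x₀⟩ := ‹Nonempty M›
  have hβ (x : M) : normSq I b g β x = normSq I b g β x₀ := by
    obtain ⟨y, hy⟩ := Function.ne_iff.1 hν
    obtain ⟨X, Y, hXY, hX, hY⟩ := hg'.exists_orthogonal hdim hy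
    have := (h x y X Y).symm.trans (h x₀ y X Y)
    rw [hXY] at this
    refine mul_right_cancel₀ (mul_ne_zero hX hY) ?_
    linarith
  refine ⟨⟨_, hβ⟩, fun hφ => ⟨normSq I b g α x₀, fun x => ?_⟩⟩
  obtain ⟨y, hy⟩ := Function.ne_iff.1 hφ
  obtain ⟨i⟩ := ‹Nonempty ι'›
  set X := tangentBasis I' b' y i
  have hne : g' y X X ≠ 0 := (hg'.neg y X (Module.Basis.ne_zero _ i)).ne
  have := (h x y X X).symm.trans (h x₀ y X X)
  rw [hβ x] at this
  refine mul_left_cancel₀ (mul_ne_zero hne (pow_ne_zero 2 hy)) ?_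
  linarith

theorem normSq_const_of_add_snd [Nonempty M'] (hn : n ≠ 0) (hg : IsLorentzian I b g)
    (hg' : IsNegRiemannian I' b' g')
    (hE : SupergravityEinstein (I.prod I') (b.prod b') (prodMetric g g') F)
    {ϖ : FormField I M 1} {ε : FormField I' M' 3} {ψ : M → ℝ} {θ : FormField I' M' 4}
    (hF : F = fun p => wedgeProd ϖ ε p + ψ p.1 • pullSnd I M θ p) (hϖ : ϖ ≠ 0) :
    (∃ c : ℝ, (∀ y, normSq I' b' g' ε y = c) ∧ (ε ≠ 0 → c < 0)) ∧
      (ψ ≠ 0 → ∃ c : ℝ, ∀ y, normSq I' b' g' θ y = c) := by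
  have h := SupergravityEinstein.ricci_fst_of_add hg.nondegenerate hg'.nondegenerate hE hF
  obtain ⟨y₀⟩ := ‹Nonempty M'›
  have hε (y : M') : normSq I' b' g' ε y = normSq I' b' g' ε y₀ := by
    obtain ⟨x, hx⟩ := Function.ne_iff.1 hϖ
    obtain ⟨X, hXX, hX⟩ := hg.exists_null hn hx
    have := (h x y X X).symm.trans (h x y₀ X X)
    rw [hXX] at this
    refine mul_left_cancel₀ (mul_ne_zero hX hX) ?_
    linarith
  refine ⟨⟨_, hε, fun hε0 => ?_⟩, fun hψ => ⟨normSq I' b' g' θ y₀, fun y => ?_⟩⟩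
  · obtain ⟨y, hy⟩ := Function.ne_iff.1 hε0
    have := hg'.normSq_pos ε y hy
    rw [hε y] at this
    linarith
  · obtain ⟨x, hx⟩ := Function.ne_iff.1 hψ
    obtain ⟨e, he⟩ := hg.orthonormal_basis x
    have hne : g x (e 0) (e 0) ≠ 0 := by simp [he]
    have := (h x y (e 0) (e 0)).symm.trans (h x y₀ (e 0) (e 0))
    rw [hε y] at this
    refine mul_left_cancel₀ (mul_ne_zero hne (pow_ne_zero 2 hx)) ?_
    linarith

theorem almostHermitian_of_two_two [Nonempty M] (hn : n = 4) (hg : IsLorentzian I b g)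
    (hg' : IsNegRiemannian I' b' g')
    (hE : SupergravityEinstein (I.prod I') (b.prod b') (prodMetric g g') F)
    {γ : FormField I M 2} {δ : FormField I' M' 2} (hδs : IsSmoothForm I' b' δ)
    (hF : F = wedgeProd γ δ) (hδ : δ ≠ 0) (hγ : ¬ ∃ c : ℝ, ∀ x, normSq I b g γ x = c) :
    (∀ y, 0 < normSq I' b' g' δ y) ∧
      (∀ (y : M') (X Y : TangentSpace I' y), g' y X Y = 3 / normSq I' b' g' δ y *
        innerAt I' b' g' y ((δ y).curryLeft X) ((δ y).curryLeft Y)) ∧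
      IsEinstein I' b' g' 0 ∧
      ∃ J : EndField I' M', IsAlmostHermitian I' b' g' J ∧
        IsKaehlerForm I' g' J (fun y => Real.sqrt (3 / normSq I' b' g' δ y) • δ y) := by
  have h := SupergravityEinstein.ricci_of_two_two hg.nondegenerate hg'.nondegenerate hE hF
  obtain ⟨x₀⟩ := ‹Nonempty M›
  obtain ⟨x₁, hx₁⟩ : ∃ x, normSq I b g γ x ≠ normSq I b g γ x₀ := by
    by_contra! hc
    exact hγ ⟨_, hc⟩
  have hT (y : M') (X Y : TangentSpace I' y) :
      -(1 / 2) * innerAt I' b' g' y ((δ y).curryLeft X) ((δ y).curryLeft Y)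
        + (1 / 6) * g' y X Y * normSq I' b' g' δ y = 0 := by
    have e := ((h x₁ y).2 X Y).symm.trans ((h x₀ y).2 X Y)
    by_contra hne
    exact hx₁ (mul_right_cancel₀ hne e)
  obtain ⟨y₀, hy₀⟩ := Function.ne_iff.1 hδ
  have hconst (y : M') : normSq I' b' g' δ y = normSq I' b' g' δ y₀ := by
    by_contra hy
    refine hγ ⟨0, fun x => ?_⟩
    refine pairing_self_eq_zero_of_card_eq_five (by simp [hn]) (tangentBasis I b x) (g x)
      (hg.symm x) (isUnit_gram_tangentBasis b g hg.nondegenerate x) (γ x) fun X Y => ?_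
    have e := ((h x y).1 X Y).symm.trans ((h x y₀).1 X Y)
    have e' : -(1 / 2) * innerAt I b g x ((γ x).curryLeft X) ((γ x).curryLeft Y)
        + (1 / 6) * g x X Y * normSq I b g γ x = 0 := by
      by_contra hne
      exact hy (mul_right_cancel₀ hne e)
    change g x X Y * normSq I b g γ x
      = 3 * innerAt I b g x ((γ x).curryLeft X) ((γ x).curryLeft Y)
    linarith
  have hpos₀ : 0 < normSq I' b' g' δ y₀ := by
    have := hg'.normSq_pos δ y₀ hy₀
    linarith
  have hpos (y : M') : 0 < normSq I' b' g' δ y := by rw [hconst]; exact hpos₀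
  have hmetric (y : M') (X Y : TangentSpace I' y) : g' y X Y = 3 / normSq I' b' g' δ y *
      innerAt I' b' g' y ((δ y).curryLeft X) ((δ y).curryLeft Y) := by
    have h1 := hT y X Y
    have h2 := (hpos y).ne'
    field_simp
    linarith
  refine ⟨hpos, hmetric, fun y X Y => ?_, ?_⟩
  · rw [(h x₀ y).2 X Y, hT, mul_zero, zero_mul]
  · set ζ : FormField I' M' 2 := fun y => Real.sqrt (3 / normSq I' b' g' δ y) • δ y with hζ
    have hex (y : M') := exists_endomorphism (tangentBasis I' b' y) (g' y)
      (isUnit_gram_tangentBasis b' g' hg'.nondegenerate y) (ζ y)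
    choose J hJ using hex
    have hζs : IsSmoothForm I' b' ζ := fun y₁ s => by
      refine ((contDiffOn_const (c := Real.sqrt (3 / normSq I' b' g' δ y₀))).mul
        (hδs y₁ s)).congr fun z _ => ?_
      rw [hζ, ← hconst ((extChartAt I' y₁).symm z)]
      rfl
    have hpair (y : M') (X Y : TangentSpace I' y) :
        pairing (tangentBasis I' b' y) (gram (tangentBasis I' b' y) (g' y))⁻¹
          ((ζ y).curryLeft X) ((ζ y).curryLeft Y) = g' y X Y := by
      have h3 : 0 ≤ 3 / normSq I' b' g' δ y := div_nonneg (by norm_num) (hpos y).le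
      rw [hζ]
      simp only [AlternatingMap.curryLeft_smul, LinearMap.smul_apply]
      rw [pairing_smul_left, pairing_smul_right, ← mul_assoc, Real.mul_self_sqrt h3]
      exact (hmetric y X Y).symm
    have hcs (y : M') := complex_structure_of_pairing (tangentBasis I' b' y) (g' y) (hg'.symm y)
      (hg'.nondegenerate y) (ζ y) (J y) (hJ y) (hpair y)
    exact ⟨J, ⟨hζs.isSmoothEnd hg'.smooth hg'.nondegenerate hJ, fun y => (hcs y).1,
      fun y => (hcs y).2⟩, hJ⟩

end Parts

end Supergravity

theorem mainTheorem5
    {N M : Type*}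
    [TopologicalSpace N] [ChartedSpace (EuclideanSpace ℝ (Fin 5)) N] [IsManifold (𝓡 5) ∞ N]
    [T2Space N] [SecondCountableTopology N] [ConnectedSpace N]
    [TopologicalSpace M] [ChartedSpace (EuclideanSpace ℝ (Fin 6)) M] [IsManifold (𝓡 6) ∞ M]
    [T2Space M] [SecondCountableTopology M] [ConnectedSpace M]
    (gN : BilinField (𝓡 5) N) (hgN : IsLorentzian (𝓡 5) (stdBasis 5) gN)
    (g : BilinField (𝓡 6) M) (hg : IsNegRiemannian (𝓡 6) (stdBasis 6) g)
    (F : FormField ((𝓡 5).prod (𝓡 6)) (N × M) 4)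
    (hF : IsSmoothForm ((𝓡 5).prod (𝓡 6)) ((stdBasis 5).prod (stdBasis 6)) F)
    (hEin : SupergravityEinstein ((𝓡 5).prod (𝓡 6)) ((stdBasis 5).prod (stdBasis 6))
      (prodMetric gN g) F) :
    -- (1) `F = α`
    (∀ α : FormField (𝓡 5) N 4, IsSmoothForm (𝓡 5) (stdBasis 5) α →
      F = pullFst (𝓡 6) M α →
      ∃ c : ℝ, (∀ x, normSq (𝓡 5) (stdBasis 5) gN α x = c) ∧
        IsEinstein (𝓡 6) (stdBasis 6) g (c / 6)) ∧
    -- (2) `F = β ∧ ν`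
    (∀ (β : FormField (𝓡 5) N 3) (ν : FormField (𝓡 6) M 1),
      IsSmoothForm (𝓡 5) (stdBasis 5) β → IsSmoothForm (𝓡 6) (stdBasis 6) ν →
      F = wedgeProd β ν → ν ≠ 0 →
      ∃ c : ℝ, ∀ x, normSq (𝓡 5) (stdBasis 5) gN β x = c) ∧
    -- (3) `F = γ ∧ δ`
    (∀ (γ : FormField (𝓡 5) N 2) (δ : FormField (𝓡 6) M 2),
      IsSmoothForm (𝓡 5) (stdBasis 5) γ → IsSmoothForm (𝓡 6) (stdBasis 6) δ →
      F = wedgeProd γ δ → δ ≠ 0 →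
      (¬ ∃ c : ℝ, ∀ x, normSq (𝓡 5) (stdBasis 5) gN γ x = c) →
      (∀ x, 0 < normSq (𝓡 6) (stdBasis 6) g δ x) ∧
      (∀ (x : M) (X Y : TangentSpace (𝓡 6) x),
        g x X Y = 3 / normSq (𝓡 6) (stdBasis 6) g δ x *
          innerAt (𝓡 6) (stdBasis 6) g x ((δ x).curryLeft X) ((δ x).curryLeft Y)) ∧
      IsEinstein (𝓡 6) (stdBasis 6) g 0 ∧
      ∃ J : EndField (𝓡 6) M, IsAlmostHermitian (𝓡 6) (stdBasis 6) g J ∧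
        IsKaehlerForm (𝓡 6) g J
          (fun x => Real.sqrt (3 / normSq (𝓡 6) (stdBasis 6) g δ x) • δ x)) ∧
    -- (4) `F = ϖ ∧ ε`
    (∀ (ϖ : FormField (𝓡 5) N 1) (ε : FormField (𝓡 6) M 3),
      IsSmoothForm (𝓡 5) (stdBasis 5) ϖ → IsSmoothForm (𝓡 6) (stdBasis 6) ε →
      F = wedgeProd ϖ ε → ϖ ≠ 0 →
      ∃ c : ℝ, (∀ x, normSq (𝓡 6) (stdBasis 6) g ε x = c) ∧ (ε ≠ 0 → c < 0)) ∧
    -- (5) `F = θ`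
    (∀ θ : FormField (𝓡 6) M 4, IsSmoothForm (𝓡 6) (stdBasis 6) θ →
      F = pullSnd (𝓡 5) N θ →
      ∃ c : ℝ, (∀ x, normSq (𝓡 6) (stdBasis 6) g θ x = c) ∧
        IsEinstein (𝓡 5) (stdBasis 5) gN (c / 6) ∧ (θ ≠ 0 → 0 < c / 6)) ∧
    -- (6) `F = φ α + β ∧ ν`
    (∀ (φ : M → ℝ) (α : FormField (𝓡 5) N 4) (β : FormField (𝓡 5) N 3)
      (ν : FormField (𝓡 6) M 1),
      ContMDiff (𝓡 6) 𝓘(ℝ, ℝ) ∞ φ → IsSmoothForm (𝓡 5) (stdBasis 5) α →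
      IsSmoothForm (𝓡 5) (stdBasis 5) β → IsSmoothForm (𝓡 6) (stdBasis 6) ν →
      F = (fun p => φ p.2 • pullFst (𝓡 6) M α p + wedgeProd β ν p) → φ ≠ 0 → ν ≠ 0 →
      (∃ c : ℝ, ∀ x, normSq (𝓡 5) (stdBasis 5) gN β x = c) ∧
      (∃ c : ℝ, ∀ x, normSq (𝓡 5) (stdBasis 5) gN α x = c)) ∧
    -- (7) `F = ϖ ∧ ε + ψ θ`
    (∀ (ϖ : FormField (𝓡 5) N 1) (ε : FormField (𝓡 6) M 3) (ψ : N → ℝ)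
      (θ : FormField (𝓡 6) M 4),
      IsSmoothForm (𝓡 5) (stdBasis 5) ϖ → IsSmoothForm (𝓡 6) (stdBasis 6) ε →
      ContMDiff (𝓡 5) 𝓘(ℝ, ℝ) ∞ ψ → IsSmoothForm (𝓡 6) (stdBasis 6) θ →
      F = (fun p => wedgeProd ϖ ε p + ψ p.1 • pullSnd (𝓡 5) N θ p) → ϖ ≠ 0 → ψ ≠ 0 →
      (∃ c : ℝ, ∀ x, normSq (𝓡 6) (stdBasis 6) g ε x = c) ∧
      (∃ c : ℝ, ∀ x, normSq (𝓡 6) (stdBasis 6) g θ x = c)) := by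
  have : IsManifold (𝓡 5) 1 N := IsManifold.of_le (n := ∞) (by simp)
  have : IsManifold (𝓡 6) 1 M := IsManifold.of_le (n := ∞) (by simp)
  refine ⟨fun α _ hF => einstein_of_pullFst hgN hg hEin hF, fun β ν _ _ hF hν => ?_,
    fun γ δ _ hδs hF hδ hγ => almostHermitian_of_two_two rfl hgN hg hEin hδs hF hδ hγ,
    fun ϖ ε _ _ hF hϖ => ?_, fun θ _ hF => einstein_of_pullSnd hgN hg hEin hF,
    fun φ α β ν _ _ _ _ hF hφ hν => ?_, fun ϖ ε ψ θ _ _ _ _ hF hϖ hψ => ?_⟩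
  · refine (normSq_const_of_fst_add (φ := 0) (α := 0) (by simp) hgN hg hEin ?_ hν).1
    rw [hF]
    funext p
    exact ((congrArg (· + _) (zero_smul ℝ _)).trans (zero_add _)).symm
  · refine (normSq_const_of_add_snd (ψ := 0) (θ := 0) (by simp) hgN hg hEin ?_ hϖ).1
    rw [hF]
    funext p
    exact ((congrArg (_ + ·) (zero_smul ℝ _)).trans (add_zero _)).symm
  · have h := normSq_const_of_fst_add (by simp) hgN hg hEin hF hν
    exact ⟨h.1, h.2 hφ⟩
  · have h := normSq_const_of_add_snd (by simp) hgN hg hEin hF hϖ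
    obtain ⟨⟨c, hc, -⟩, h2⟩ := h
    exact ⟨⟨c, hc⟩, h2 hψ⟩
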